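/- Let $n\in\mathbb N$, $I=[0,1]$, $a>1$, and let $\mathcal H^1$ be the one-dimensional Hausdorff measure on $\mathbb R^n$. Let $\Theta$ be the set of Lipschitz curves $\theta:I\to\mathbb R^n$, with the (pseudo)metric $$d_\Theta(\theta_1,\theta_2)=\inf\Big\{\max_{t\in I}|\theta_1(t)-\theta_2(\varphi(t))| : \varphi:I\to I\text{ increasing and bijective}\Big\}$$ and its Borel $\sigma$-algebra. For finite non-negative Borel measures $\mu_+,\mu_-$ on $\mathbb R^n$, let $\mathrm{TPM}(\mu_+,\mu_-)$ be the set of non-negative Borel measures $\eta$ on $\Theta$ whose push-forwards under $\theta\mapsto\theta(0)$ and $\theta\mapsto\theta(1)$ are $\mu_+$ and $\mu_-$, respectively, and let $\Pi(\mu_+,\mu_-)$ be the set of finite non-negative Borel measures on $\mathbb R^n\times\mathbb R^n$ with first marginal $\mu_+$ and second marginal $\mu_-$. A curve $\theta\in\Theta$ is loop-free if there are no $t_1<t_2<t_3$ in $I$ with $\theta(t_1)=\theta(t_3)\neq\theta(t_2)$. For a Borel set $\Sigma\subset\mathbb R^n$ with $\mathcal H^1(\Sigma)<\infty$ put $$\delta_\Sigma(\theta)=a\,\mathcal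 H^1(\theta(I)\setminus\Sigma)+\mathcal H^1(\theta(I)\cap\Sigma),\qquad C_\Sigma^a(\eta)=\int_\Theta\delta_\Sigma(\theta)\,\mathrm d\eta(\theta),$$ $$d_\Sigma(x,y)=\inf\{\delta_\Sigma(\theta) : \theta\in\Theta,\ \theta(0)=x,\ \theta(1)=y\},\qquad W_{d_\Sigma}(\mu_+,\mu_-)=\inf_{\gamma\in\Pi(\mu_+,\mu_-)}\int_{\mathbb R^n\times\mathbb R^n}d_\Sigma(x,y)\,\mathrm d\gamma(x,y).$$ Let $\Sigma\subset\mathbb R^n$ be a bounded Borel set with $\mathcal H^1(\Sigma)<\infty$, and let $\mu_+,\mu_-$ be finite non-negative Borel measures on $\mathbb R^n$ of equal mass and with compact support. Then there exists a minimiser $\eta$ of $C_\Sigma^a$ over $\mathrm{TPM}(\mu_+,\mu_-)$ such that $\eta$-a.e. $\theta\in\Theta$ is loop-free. Furthermore, $$C_\Sigma^a(\eta)=W_{d_\Sigma}(\mu_+,\mu_-).$$ -/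

import Mathlib

open MeasureTheory Set
open scoped ENNReal NNReal unitInterval MeasureTheory

noncomputable section

namespace UrbanPlanning

/-- The Euclidean space `ℝⁿ`. -/
abbrev E (n : ℕ) : Type := EuclideanSpace ℝ (Fin n)

/-- The set `Θ` of Lipschitz curves `[0,1] → ℝⁿ`. It is a structure, so that it carries no
topology other than the one defined below. -/
structure LipPath (n : ℕ) where
  toFun : I → E n
  lipschitz : ∃ K : ℝ≥0, LipschitzWith K toFun

namespace LipPath

variable {n : ℕ}

instance : CoeFun (LipPath n) (fun _ => I → E n) := ⟨LipPath.toFun⟩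

theorem continuous (θ : LipPath n) : Continuous θ := by
  obtain ⟨K, hK⟩ := θ.lipschitz
  exact hK.continuous

/-- `max_{t ∈ [0,1]} |θ₁(t) - θ₂(φ(t))|`, for an increasing bijection `φ` of `[0,1]`. -/
def supDist (θ₁ θ₂ : LipPath n) (φ : I ≃o I) : ℝ :=
  ⨆ t : I, dist (θ₁ t) (θ₂ (φ t))

/-- The distance `d_Θ`: the infimum of the maximal distances over all increasing bijections
`φ : [0,1] → [0,1]`. -/
def pathDist (θ₁ θ₂ : LipPath n) : ℝ :=
  ⨅ φ : I ≃o I, supDist θ₁ θ₂ φ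

theorem le_supDist (θ₁ θ₂ : LipPath n) (φ : I ≃o I) (t : I) :
    dist (θ₁ t) (θ₂ (φ t)) ≤ supDist θ₁ θ₂ φ := by
  have hc : Continuous fun t : I => dist (θ₁ t) (θ₂ (φ t)) :=
    θ₁.continuous.dist (θ₂.continuous.comp φ.continuous)
  exact le_ciSup (isCompact_range hc).bddAbove t

theorem supDist_nonneg (θ₁ θ₂ : LipPath n) (φ : I ≃o I) : 0 ≤ supDist θ₁ θ₂ φ :=
  dist_nonneg.trans (le_supDist θ₁ θ₂ φ 0)

theorem pathDist_le (θ₁ θ₂ : LipPath n) (φ : I ≃o I) : pathDist θ₁ θ₂ ≤ supDist θ₁ θ₂ φ :=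
  ciInf_le ⟨0, by rintro _ ⟨ψ, rfl⟩; exact supDist_nonneg θ₁ θ₂ ψ⟩ φ

theorem pathDist_self (θ : LipPath n) : pathDist θ θ = 0 := by
  refine le_antisymm ((pathDist_le θ θ (OrderIso.refl _)).trans ?_)
    (le_ciInf fun φ => supDist_nonneg θ θ φ)
  exact ciSup_le fun t => by simp

theorem pathDist_comm_le (θ₁ θ₂ : LipPath n) : pathDist θ₁ θ₂ ≤ pathDist θ₂ θ₁ := by
  refine le_ciInf fun φ => (pathDist_le θ₁ θ₂ φ.symm).trans (ciSup_le fun t => ?_)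
  have h := le_supDist θ₂ θ₁ φ (φ.symm t)
  rwa [φ.apply_symm_apply, dist_comm] at h

theorem pathDist_triangle (θ₁ θ₂ θ₃ : LipPath n) :
    pathDist θ₁ θ₃ ≤ pathDist θ₁ θ₂ + pathDist θ₂ θ₃ := by
  refine le_ciInf_add_ciInf fun φ ψ =>
    (pathDist_le θ₁ θ₃ (φ.trans ψ)).trans (ciSup_le fun t => ?_)
  exact (dist_triangle _ (θ₂ (φ t)) _).trans
    (add_le_add (le_supDist θ₁ θ₂ φ t) (le_supDist θ₂ θ₃ ψ (φ t)))

/-- `Θ` with `d_Θ`. Curves that agree up to reparameterisation have distance zero and are not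
separated by the topology; passing to the quotient would give the same Borel sets and measures. -/
instance : PseudoMetricSpace (LipPath n) where
  dist := pathDist
  dist_self := pathDist_self
  dist_comm θ₁ θ₂ := le_antisymm (pathDist_comm_le θ₁ θ₂) (pathDist_comm_le θ₂ θ₁)
  dist_triangle := pathDist_triangle

instance : MeasurableSpace (LipPath n) := borel (LipPath n)

instance : BorelSpace (LipPath n) := ⟨rfl⟩

/-- The curve takes the same value at two times, and a different one in between. -/
def HasLoop (θ : LipPath n) : Prop :=
  ∃ t₁ t₂ t₃ : I, t₁ < t₂ ∧ t₂ < t₃ ∧ θ t₁ = θ t₃ ∧ θ t₂ ≠ θ t₁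

/-- The curve has no loop. -/
def LoopFree (θ : LipPath n) : Prop := ¬ θ.HasLoop

end LipPath

/-- Cost of a path: `a` per unit of length off `S`, and `1` per unit of length on `S`. -/
def pathCost {n : ℕ} (a : ℝ) (S : Set (E n)) (θ : LipPath n) : ℝ≥0∞ :=
  ENNReal.ofReal a * μH[1] (range θ \ S) + μH[1] (range θ ∩ S)

/-- The Lipschitz curves from `x` to `y`. -/
def pathsBetween {n : ℕ} (x y : E n) : Set (LipPath n) := {θ | θ 0 = x ∧ θ 1 = y}

/-- The urban planning metric `d_S`. -/
def urbanDist {n : ℕ} (a : ℝ) (S : Set (E n)) (x y : E n) : ℝ≥0∞ :=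
  ⨅ θ ∈ pathsBetween x y, pathCost a S θ

/-- Transport plans: finite Borel measures on `ℝⁿ × ℝⁿ` with the two prescribed marginals. -/
def transportPlans {n : ℕ} (μp μm : Measure (E n)) : Set (Measure (E n × E n)) :=
  {γ | IsFiniteMeasure γ ∧ γ.map Prod.fst = μp ∧ γ.map Prod.snd = μm}

/-- The Wasserstein distance induced by `d_S`. -/
def wasserstein {n : ℕ} (a : ℝ) (S : Set (E n)) (μp μm : Measure (E n)) : ℝ≥0∞ :=
  ⨅ γ ∈ transportPlans μp μm, ∫⁻ z, urbanDist a S z.1 z.2 ∂γ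

/-- Transport path measures moving `μp` onto `μm`: Borel measures on `Θ` whose push-forwards under
the evaluations at times `0` and `1` are `μp` and `μm`. -/
def transportPathMeasures {n : ℕ} (μp μm : Measure (E n)) : Set (Measure (LipPath n)) :=
  {η | η.map (fun θ => θ 0) = μp ∧ η.map (fun θ => θ 1) = μm}

/-- The cost functional `C_S^a` on transport path measures. -/
def tpmCost {n : ℕ} (a : ℝ) (S : Set (E n)) (η : Measure (LipPath n)) : ℝ≥0∞ :=
  ∫⁻ θ, pathCost a S θ ∂η

end UrbanPlanning

end

namespace UrbanPlanning

/-! The urban metric `d` lies between the Euclidean distance and `a` times it, so it induces the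
Euclidean topology and its bounded closed sets are compact. Almost optimal paths can be cut at any
prescribed `d`-distance from their start, so constant-speed `d`-geodesics exist between any two
points (`exists_isGeodesic`).

The crux is that the image of a geodesic costs no more than the distance of its endpoints
(`IsGeodesic.costMeasure_range_le`), although `S` is only Borel and the geodesic is only a limit.
Cut it into short pieces and replace each by an almost optimal path at least as long as the diameter
of the piece. The total cost is almost `d`, and the concatenation costs at least `d`, so the paths
hardly overlap. Their total length in `S \ K`, for compact `K ⊆ S`, is thus hardly more than that of
`S \ K`, and `S` may be replaced by `K`. Short paths that start far from the closed set `K` miss it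
and carry the weight `a`. Refining the cut bounds Hausdorff measure by sums of diameters; then `K`
exhausts `S`.

Geodesics between the two supports form a compact space mapped continuously onto the pairs of
endpoints, so every transport plan lifts to a measure on it (`exists_lift_transportPlan`). By weak
compactness the integral of `d` between endpoints has a minimiser there. Its push-forward to curves
costs at most the Wasserstein distance, which bounds the cost of every transport path measure from
below. Geodesics have no loops. -/

theorem edist_le_hausdorffMeasure_of_isPreconnected {X : Type*} [MetricSpace X]
    [MeasurableSpace X] [BorelSpace X] {R : Set X} (hR : IsPreconnected R) {u v : X}
    (hu : u ∈ R) (hv : v ∈ R) : edist u v ≤ μH[1] R := by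
  -- The distance to `u` does not increase `μH[1]`, and by connectedness it maps `R` onto a set
  -- containing `[0, dist u v]`.
  have hf : LipschitzWith 1 (fun z => dist u z) := LipschitzWith.dist_right u
  have h1 : μH[1] ((fun z => dist u z) '' R) ≤ μH[1] R := by
    simpa using hf.hausdorffMeasure_image_le zero_le_one R
  have h2 : Icc 0 (dist u v) ⊆ (fun z => dist u z) '' R :=
    (hR.image _ hf.continuous.continuousOn).Icc_subset ⟨u, hu, dist_self u⟩ ⟨v, hv, rfl⟩
  refine le_trans ?_ ((measure_mono h2).trans h1)
  rw [hausdorffMeasure_real, Real.volume_Icc, sub_zero, edist_dist]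

/-! ### Operations on Lipschitz curves -/

namespace LipPath

variable {n : ℕ}

/-- The straight path from `x` to `y`. -/
noncomputable def straight (x y : E n) : LipPath n where
  toFun t := AffineMap.lineMap x y (t : ℝ)
  lipschitz := ⟨nndist x y * 1, (lipschitzWith_lineMap x y).comp (LipschitzWith.subtype_val _)⟩

theorem range_straight_subset (x y : E n) : range (straight x y) ⊆ segment ℝ x y := by
  rintro _ ⟨t, rfl⟩
  rw [segment_eq_image_lineMap]
  exact ⟨t, t.2, rfl⟩

/-- The path `t ↦ θ (f t)`, with `f t` projected to `[0, 1]`. -/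
noncomputable def reparam (θ : LipPath n) (f : ℝ → ℝ) (hf : ∃ K, LipschitzWith K f) : LipPath n where
  toFun t := θ (projIcc 0 1 zero_le_one (f t))
  lipschitz := by
    obtain ⟨K, hK⟩ := θ.lipschitz
    obtain ⟨L, hL⟩ := hf
    exact ⟨_, hK.comp ((LipschitzWith.projIcc zero_le_one).comp
      (hL.comp (LipschitzWith.subtype_val _)))⟩

theorem lipschitz_affine (c d : ℝ) : ∃ K, LipschitzWith K (fun t : ℝ => c + d * t) :=
  ⟨‖d‖₊, LipschitzWith.of_dist_le_mul fun s t => by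
    rw [Real.dist_eq, Real.dist_eq, coe_nnnorm, Real.norm_eq_abs, ← abs_mul]
    apply le_of_eq; congr 1; ring⟩

/-- The part of `θ` between the times `u` and `v`. -/
noncomputable def subpath (θ : LipPath n) (u v : I) : LipPath n :=
  θ.reparam (fun t => u + (v - u) * t) (lipschitz_affine _ _)

@[simp] theorem subpath_zero (θ : LipPath n) (u v : I) : θ.subpath u v 0 = θ u := by
  simp [subpath, reparam]

@[simp] theorem subpath_one (θ : LipPath n) (u v : I) : θ.subpath u v 1 = θ v := by
  simp [subpath, reparam]

theorem range_subpath_subset (θ : LipPath n) {u v : I} (huv : u ≤ v) :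
    range (θ.subpath u v) ⊆ θ '' Icc u v := by
  rintro _ ⟨t, rfl⟩
  have huv' : (u : ℝ) ≤ v := huv
  have ht0 := t.2.1
  have ht1 := t.2.2
  have hu := u.2.1
  have hv := v.2.2
  have h1 : (u : ℝ) ≤ u + (v - u) * t := by nlinarith
  have h2 : (u : ℝ) + (v - u) * t ≤ v := by nlinarith
  refine ⟨⟨u + (v - u) * t, hu.trans h1, h2.trans hv⟩, ⟨h1, h2⟩, ?_⟩
  simp only [subpath, reparam]
  rw [projIcc_of_mem zero_le_one ⟨hu.trans h1, h2.trans hv⟩]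

/-- The reversed path. -/
noncomputable def reverse (θ : LipPath n) : LipPath n := θ.subpath 1 0

theorem range_reverse_subset (θ : LipPath n) : range θ.reverse ⊆ range θ := by
  rintro _ ⟨t, rfl⟩
  exact ⟨_, rfl⟩

/-- The concatenation of two paths. -/
noncomputable def trans (θ₁ θ₂ : LipPath n) : LipPath n where
  -- Clamping freezes one summand on each half, at `θ₂ 0` and then at `θ₁ 1`. If these agree,
  -- subtracting `θ₁ 1` leaves the moving path, and the Lipschitz bound needs no gluing.
  toFun t := θ₁.reparam (fun t => 0 + 2 * t) (lipschitz_affine _ _) t +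
    θ₂.reparam (fun t => -1 + 2 * t) (lipschitz_affine _ _) t - θ₁ 1
  lipschitz := by
    obtain ⟨K, hK⟩ := (θ₁.reparam (fun t => 0 + 2 * t) (lipschitz_affine _ _)).lipschitz
    obtain ⟨L, hL⟩ := (θ₂.reparam (fun t => -1 + 2 * t) (lipschitz_affine _ _)).lipschitz
    exact ⟨_, (hK.add hL).sub (LipschitzWith.const (θ₁ 1))⟩

theorem trans_apply_left (θ₁ θ₂ : LipPath n) (h : θ₁ 1 = θ₂ 0) {t : I} (ht : (t : ℝ) ≤ 1 / 2) :
    θ₁.trans θ₂ t = θ₁ (projIcc 0 1 zero_le_one (2 * t)) := by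
  simp only [trans, reparam, zero_add]
  rw [projIcc_of_le_left zero_le_one (x := -1 + 2 * (t : ℝ)) (by linarith), h]
  exact add_sub_cancel_right _ _

theorem trans_apply_right (θ₁ θ₂ : LipPath n) {t : I} (ht : 1 / 2 ≤ (t : ℝ)) :
    θ₁.trans θ₂ t = θ₂ (projIcc 0 1 zero_le_one (-1 + 2 * t)) := by
  simp only [trans, reparam, zero_add]
  rw [projIcc_of_right_le zero_le_one (x := 2 * (t : ℝ)) (by linarith)]
  exact add_sub_cancel_left _ _

theorem trans_zero (θ₁ θ₂ : LipPath n) (h : θ₁ 1 = θ₂ 0) : θ₁.trans θ₂ 0 = θ₁ 0 := by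
  rw [trans_apply_left _ _ h (by simp)]
  simp

theorem trans_one (θ₁ θ₂ : LipPath n) : θ₁.trans θ₂ 1 = θ₂ 1 := by
  rw [trans_apply_right _ _ (by norm_num)]
  norm_num

theorem range_trans_subset (θ₁ θ₂ : LipPath n) (h : θ₁ 1 = θ₂ 0) :
    range (θ₁.trans θ₂) ⊆ range θ₁ ∪ range θ₂ := by
  rintro _ ⟨t, rfl⟩
  rcases le_total (t : ℝ) (1 / 2) with ht | ht
  · exact Or.inl ⟨_, (trans_apply_left θ₁ θ₂ h ht).symm⟩
  · exact Or.inr ⟨_, (trans_apply_right θ₁ θ₂ ht).symm⟩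

theorem range_subset_range_trans_left (θ₁ θ₂ : LipPath n) (h : θ₁ 1 = θ₂ 0) :
    range θ₁ ⊆ range (θ₁.trans θ₂) := by
  rintro _ ⟨t, rfl⟩
  have h0 := t.2.1
  have h1 := t.2.2
  refine ⟨⟨t / 2, by linarith, by linarith⟩, ?_⟩
  rw [trans_apply_left _ _ h (by simp only; linarith), mul_div_cancel₀ _ two_ne_zero,
    projIcc_val]

theorem range_subset_range_trans_right (θ₁ θ₂ : LipPath n) :
    range θ₂ ⊆ range (θ₁.trans θ₂) := by
  rintro _ ⟨t, rfl⟩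
  have h0 := t.2.1
  have h1 := t.2.2
  refine ⟨⟨(t + 1) / 2, by linarith, by linarith⟩, ?_⟩
  rw [trans_apply_right _ _ (by simp only; linarith), mul_div_cancel₀ _ two_ne_zero,
    show (-1 : ℝ) + (t + 1) = t by ring, projIcc_val]

theorem isPreconnected_range (θ : LipPath n) : IsPreconnected (range θ) :=
  _root_.isPreconnected_range θ.continuous

end LipPath

/-- The measure with density `a` off `S` and `1` on `S` with respect to `μH[1]`. -/
noncomputable def costMeasure {n : ℕ} (a : ℝ) (S : Set (E n)) : Measure (E n) :=
  ENNReal.ofReal a • μH[1].restrict Sᶜ + μH[1].restrict S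

/-! ### The urban metric and its comparison with the Euclidean one -/

section Cost

variable {n : ℕ} {a : ℝ} {S : Set (E n)}

theorem costMeasure_apply (hS : MeasurableSet S) (A : Set (E n)) :
    costMeasure a S A = ENNReal.ofReal a * μH[1] (A \ S) + μH[1] (A ∩ S) := by
  simp [costMeasure, Measure.restrict_apply' hS, Measure.restrict_apply' hS.compl, sdiff_eq]

theorem pathCost_eq (hS : MeasurableSet S) (θ : LipPath n) :
    pathCost a S θ = costMeasure a S (range θ) := (costMeasure_apply hS _).symm

theorem hausdorffMeasure_le_costMeasure (ha : 1 ≤ a) (hS : MeasurableSet S) (A : Set (E n)) :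
    μH[1] A ≤ costMeasure a S A := by
  rw [costMeasure_apply hS, ← measure_inter_add_sdiff A hS, add_comm]
  gcongr
  exact le_mul_of_one_le_left' (by simpa using ha)

theorem costMeasure_le (ha : 1 ≤ a) (hS : MeasurableSet S) (A : Set (E n)) :
    costMeasure a S A ≤ ENNReal.ofReal a * μH[1] A := by
  rw [costMeasure_apply hS, ← measure_inter_add_sdiff A hS, add_comm, mul_add]
  gcongr
  exact le_mul_of_one_le_left' (by simpa using ha)

/-- Writing `a = 1 + (a - 1)` confines the dependence on `S` to the second term, which makes
replacing `S` by a compact subset easy to control. -/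
theorem costMeasure_eq_add (ha : 1 ≤ a) (hS : MeasurableSet S) (A : Set (E n)) :
    costMeasure a S A = μH[1] A + ENNReal.ofReal (a - 1) * μH[1] (A \ S) := by
  have h : ENNReal.ofReal a = 1 + ENNReal.ofReal (a - 1) := by
    rw [← ENNReal.ofReal_one, ← ENNReal.ofReal_add zero_le_one (by linarith)]
    congr 1; ring
  rw [costMeasure_apply hS, ← measure_inter_add_sdiff A hS, h]
  ring

theorem costMeasure_singleton (ha : 1 ≤ a) (hS : MeasurableSet S) (x : E n) :
    costMeasure a S {x} = 0 := by
  refine le_antisymm ((costMeasure_le ha hS _).trans ?_) zero_le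
  have : μH[1] ({x} : Set (E n)) = 0 := by
    have := Measure.nullSingletonClass_hausdorff (E n) (d := 1) one_pos
    exact measure_singleton x
  simp [this]

theorem urbanDist_le_of_range_subset (hS : MeasurableSet S) {x y : E n} (θ : LipPath n)
    (h0 : θ 0 = x) (h1 : θ 1 = y) {A : Set (E n)} (hA : range θ ⊆ A) :
    urbanDist a S x y ≤ costMeasure a S A :=
  (iInf₂_le θ ⟨h0, h1⟩).trans ((pathCost_eq hS θ).trans_le (measure_mono hA))

theorem urbanDist_le (ha : 1 ≤ a) (hS : MeasurableSet S) (x y : E n) :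
    urbanDist a S x y ≤ ENNReal.ofReal a * edist x y := by
  refine (urbanDist_le_of_range_subset hS (LipPath.straight x y) (by simp [LipPath.straight])
    (by simp [LipPath.straight]) (LipPath.range_straight_subset x y)).trans ?_
  refine (costMeasure_le ha hS _).trans_eq ?_
  rw [hausdorffMeasure_segment]

theorem urbanDist_ne_top (ha : 1 ≤ a) (hS : MeasurableSet S) (x y : E n) :
    urbanDist a S x y ≠ ⊤ :=
  ne_top_of_le_ne_top (ENNReal.mul_ne_top ENNReal.ofReal_ne_top (edist_ne_top _ _))
    (urbanDist_le ha hS x y)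

theorem edist_le_urbanDist (ha : 1 ≤ a) (hS : MeasurableSet S) (x y : E n) :
    edist x y ≤ urbanDist a S x y := by
  refine le_iInf₂ fun θ hθ => ?_
  rw [pathCost_eq hS]
  refine le_trans ?_ (hausdorffMeasure_le_costMeasure ha hS _)
  exact edist_le_hausdorffMeasure_of_isPreconnected θ.isPreconnected_range ⟨0, hθ.1⟩ ⟨1, hθ.2⟩

theorem exists_path_lt (hS : MeasurableSet S) {x y : E n} {c : ℝ≥0∞}
    (h : urbanDist a S x y < c) :
    ∃ θ : LipPath n, θ 0 = x ∧ θ 1 = y ∧ costMeasure a S (range θ) < c := by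
  simp only [urbanDist, iInf_lt_iff] at h
  obtain ⟨θ, hθ, hc⟩ := h
  exact ⟨θ, hθ.1, hθ.2, by rwa [← pathCost_eq hS]⟩

theorem urbanDist_comm_le (hS : MeasurableSet S) (x y : E n) :
    urbanDist a S x y ≤ urbanDist a S y x := by
  refine le_iInf₂ fun θ hθ => ?_
  rw [pathCost_eq hS]
  exact urbanDist_le_of_range_subset hS θ.reverse (by simp [LipPath.reverse, hθ.2])
    (by simp [LipPath.reverse, hθ.1]) θ.range_reverse_subset

theorem urbanDist_comm (hS : MeasurableSet S) (x y : E n) :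
    urbanDist a S x y = urbanDist a S y x :=
  le_antisymm (urbanDist_comm_le hS x y) (urbanDist_comm_le hS y x)

theorem urbanDist_triangle (hS : MeasurableSet S) (x y z : E n) :
    urbanDist a S x z ≤ urbanDist a S x y + urbanDist a S y z := by
  refine ENNReal.le_of_forall_pos_le_add fun ε hε hfin => ?_
  have hε' : (ε / 2 : ℝ≥0∞) ≠ 0 := by simpa using hε.ne'
  have hx : urbanDist a S x y ≠ ⊤ := (lt_of_le_of_lt le_self_add hfin).ne
  have hy : urbanDist a S y z ≠ ⊤ := (lt_of_le_of_lt le_add_self hfin).ne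
  obtain ⟨θ₁, h10, h11, h1⟩ := exists_path_lt hS (ENNReal.lt_add_right hx hε')
  obtain ⟨θ₂, h20, h21, h2⟩ := exists_path_lt hS (ENNReal.lt_add_right hy hε')
  have h : θ₁ 1 = θ₂ 0 := h11.trans h20.symm
  refine (urbanDist_le_of_range_subset hS (θ₁.trans θ₂) ((LipPath.trans_zero _ _ h).trans h10)
    ((LipPath.trans_one _ _).trans h21) (LipPath.range_trans_subset _ _ h)).trans ?_
  refine (measure_union_le _ _).trans ((add_le_add h1.le h2.le).trans_eq ?_)
  rw [add_add_add_comm, ENNReal.add_halves]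

/-- The urban planning metric as a real number. -/
noncomputable def realDist {n : ℕ} (a : ℝ) (S : Set (E n)) (x y : E n) : ℝ :=
  (urbanDist a S x y).toReal

theorem realDist_nonneg (x y : E n) : 0 ≤ realDist a S x y := ENNReal.toReal_nonneg

theorem ofReal_realDist (ha : 1 ≤ a) (hS : MeasurableSet S) (x y : E n) :
    ENNReal.ofReal (realDist a S x y) = urbanDist a S x y :=
  ENNReal.ofReal_toReal (urbanDist_ne_top ha hS x y)

theorem realDist_comm (hS : MeasurableSet S) (x y : E n) :
    realDist a S x y = realDist a S y x := by
  rw [realDist, urbanDist_comm hS, realDist]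

theorem realDist_triangle (ha : 1 ≤ a) (hS : MeasurableSet S) (x y z : E n) :
    realDist a S x z ≤ realDist a S x y + realDist a S y z := by
  have hx := urbanDist_ne_top ha hS x y
  have hy := urbanDist_ne_top ha hS y z
  rw [realDist, realDist, realDist, ← ENNReal.toReal_add hx hy]
  exact ENNReal.toReal_mono (ENNReal.add_ne_top.2 ⟨hx, hy⟩) (urbanDist_triangle hS x y z)

theorem realDist_le (ha : 1 ≤ a) (hS : MeasurableSet S) (x y : E n) :
    realDist a S x y ≤ a * dist x y := by
  rw [realDist]
  refine ENNReal.toReal_le_of_le_ofReal (by positivity) ?_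
  rw [ENNReal.ofReal_mul (by linarith), ← edist_dist]
  exact urbanDist_le ha hS x y

theorem dist_le_realDist (ha : 1 ≤ a) (hS : MeasurableSet S) (x y : E n) :
    dist x y ≤ realDist a S x y := by
  rw [dist_edist]
  exact ENNReal.toReal_mono (urbanDist_ne_top ha hS x y) (edist_le_urbanDist ha hS x y)

theorem realDist_self (ha : 1 ≤ a) (hS : MeasurableSet S) (x : E n) :
    realDist a S x x = 0 :=
  le_antisymm (by simpa using realDist_le ha hS x x) (realDist_nonneg x x)

theorem continuous_realDist (ha : 1 ≤ a) (hS : MeasurableSet S) :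
    Continuous fun z : E n × E n => realDist a S z.1 z.2 := by
  refine (LipschitzWith.of_dist_le_mul (K := (2 * a).toNNReal) fun z w => ?_).continuous
  have ha0 : 0 ≤ a := by linarith
  rw [Real.coe_toNNReal _ (by positivity), Real.dist_eq]
  have h1 : a * dist z.1 w.1 ≤ a * dist z w :=
    mul_le_mul_of_nonneg_left (le_max_left _ _) ha0
  have h2 : a * dist z.2 w.2 ≤ a * dist z w :=
    mul_le_mul_of_nonneg_left (le_max_right _ _) ha0
  have e1 := realDist_le ha hS z.1 w.1
  have e2 := realDist_le ha hS z.2 w.2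
  have c1 := realDist_comm (a := a) hS z.1 w.1
  have c2 := realDist_comm (a := a) hS z.2 w.2
  have t1 := realDist_triangle ha hS z.1 w.1 z.2
  have t2 := realDist_triangle ha hS w.1 w.2 z.2
  have t3 := realDist_triangle ha hS w.1 z.1 w.2
  have t4 := realDist_triangle ha hS z.1 z.2 w.2
  rw [abs_le]
  constructor <;> linarith

theorem continuous_realDist_comp (ha : 1 ≤ a) (hS : MeasurableSet S) {X : Type*}
    [TopologicalSpace X] {f g : X → E n} (hf : Continuous f) (hg : Continuous g) :
    Continuous fun x => realDist a S (f x) (g x) := by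
  have h := (continuous_realDist (a := a) ha hS).comp (hf.prodMk hg)
  exact h

end Cost

/-! ### Existence of geodesics -/

section Geodesics

open Filter Topology

variable {n : ℕ} {a : ℝ} {S : Set (E n)}

/-- The curve stays inside the open `d`-ball of radius `s` until it first meets the sphere and
outside after it last does. These two parts have disjoint images, so their costs add up even though
the cost counts multiply covered points once. -/
theorem exists_point_add_urbanDist_le (ha : 1 ≤ a) (hS : MeasurableSet S) (θ : LipPath n) {s : ℝ}
    (hs0 : 0 ≤ s) (hs1 : s ≤ realDist a S (θ 0) (θ 1)) :
    ∃ z, realDist a S (θ 0) z = s ∧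
      ENNReal.ofReal s + urbanDist a S z (θ 1) ≤ costMeasure a S (range θ) := by
  set f : I → ℝ := fun t => realDist a S (θ 0) (θ t) with hf
  have hfc : Continuous f := continuous_realDist_comp ha hS continuous_const θ.continuous
  have hf0 : f 0 = 0 := realDist_self ha hS _
  have hT : IsCompact {t | f t = s} := (isClosed_eq hfc continuous_const).isCompact
  have hne : {t | f t = s}.Nonempty := by
    obtain ⟨t, ht⟩ := intermediate_value_univ 0 1 hfc ⟨hf0.trans_le hs0, hs1⟩
    exact ⟨t, ht⟩
  obtain ⟨t₁, ht₁, hmin⟩ := hT.exists_isLeast hne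
  obtain ⟨t₂, ht₂, hmax⟩ := hT.exists_isGreatest hne
  have hlt : ∀ t < t₁, f t < s := by
    intro t ht
    by_contra! hst
    obtain ⟨t₀, ht₀, h⟩ := intermediate_value_Icc (unitInterval.nonneg' (t := t))
      hfc.continuousOn ⟨hf0.trans_le hs0, hst⟩
    exact absurd (hmin h) (not_le.2 (ht₀.2.trans_lt ht))
  have hge : ∀ t, t₂ ≤ t → s ≤ f t := by
    intro t ht
    by_contra! hst
    obtain ⟨t₀, ht₀, h⟩ := intermediate_value_Icc (unitInterval.le_one' (t := t))
      hfc.continuousOn ⟨hst.le, hs1⟩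
    have : t₀ = t := le_antisymm ((hmax h).trans ht) ht₀.1
    rw [this] at h
    exact hst.ne h
  have hP : MeasurableSet {z | realDist a S (θ 0) z < s} :=
    (isOpen_lt (continuous_realDist_comp ha hS continuous_const continuous_id)
      continuous_const).measurableSet
  refine ⟨θ t₂, ht₂, ?_⟩
  rw [← measure_inter_add_sdiff (range θ) hP]
  refine add_le_add ?_ ?_
  · have h1 : urbanDist a S (θ 0) (θ t₁) = ENNReal.ofReal s := by
      rw [← ofReal_realDist ha hS]
      exact congrArg _ ht₁
    rw [← h1]
    -- The endpoint `θ t₁` lies on the sphere rather than in the ball, but a single point has no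
    -- cost.
    refine (urbanDist_le_of_range_subset hS (θ.subpath 0 t₁) (by simp) (by simp)
      (A := range θ ∩ {z | realDist a S (θ 0) z < s} ∪ {θ t₁}) ?_).trans ?_
    · refine (θ.range_subpath_subset unitInterval.nonneg').trans ?_
      rintro _ ⟨t, ht, rfl⟩
      rcases ht.2.lt_or_eq with h | h
      · exact Or.inl ⟨⟨t, rfl⟩, hlt t h⟩
      · exact Or.inr (congrArg θ h)
    · refine (measure_union_le _ _).trans_eq ?_
      rw [costMeasure_singleton ha hS, add_zero]
  · refine urbanDist_le_of_range_subset hS (θ.subpath t₂ 1) (by simp) (by simp) ?_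
    refine (θ.range_subpath_subset unitInterval.le_one').trans ?_
    rintro _ ⟨t, ht, rfl⟩
    exact ⟨⟨t, rfl⟩, not_lt.2 (hge t ht.1)⟩

/-- The `d`-sphere about `x` is compact, so a point on it closest to `y` removes the error `ε` of
almost optimal paths. -/
theorem exists_realDist_eq_and_le (ha : 1 ≤ a) (hS : MeasurableSet S) (x y : E n) {s : ℝ}
    (hs0 : 0 ≤ s) (hs1 : s ≤ realDist a S x y) :
    ∃ z, realDist a S x z = s ∧ realDist a S z y ≤ realDist a S x y - s := by
  have key : ∀ ε : ℝ, 0 < ε → ∃ z, realDist a S x z = s ∧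
      realDist a S z y ≤ realDist a S x y - s + ε := by
    intro ε hε
    obtain ⟨θ, rfl, rfl, h⟩ := exists_path_lt hS (ENNReal.lt_add_right
      (urbanDist_ne_top ha hS x y) (ENNReal.ofReal_pos.2 hε).ne')
    obtain ⟨z, hz, hz'⟩ := exists_point_add_urbanDist_le ha hS θ hs0 hs1
    refine ⟨z, hz, ?_⟩
    have h2 := hz'.trans h.le
    rw [← ofReal_realDist ha hS, ← ofReal_realDist ha hS, ← ENNReal.ofReal_add hs0
      (realDist_nonneg _ _), ← ENNReal.ofReal_add (realDist_nonneg _ _) hε.le,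
      ENNReal.ofReal_le_ofReal_iff (add_nonneg (realDist_nonneg _ _) hε.le)] at h2
    linarith
  have hcl : IsClosed {z | realDist a S x z = s} :=
    isClosed_eq (continuous_realDist_comp ha hS continuous_const continuous_id) continuous_const
  have hC : IsCompact {z | realDist a S x z = s} := by
    refine (isCompact_closedBall x s).of_isClosed_subset hcl fun z hz => ?_
    rw [Metric.mem_closedBall, dist_comm]
    exact (dist_le_realDist ha hS x z).trans_eq hz
  obtain ⟨z₁, hz₁, -⟩ := key 1 one_pos
  obtain ⟨z₀, hz₀, hmin⟩ := hC.exists_isMinOn ⟨z₁, hz₁⟩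
    (continuous_realDist_comp (a := a) ha hS continuous_id (continuous_const (y := y))).continuousOn
  refine ⟨z₀, hz₀, le_of_forall_pos_le_add fun ε hε => ?_⟩
  obtain ⟨z, hz, hz'⟩ := key ε hε
  exact (hmin hz).trans hz'

theorem exists_chain (ha : 1 ≤ a) (hS : MeasurableSet S) (y : E n) {δ : ℝ} (hδ : 0 ≤ δ) (N : ℕ) :
    ∀ x : E n, realDist a S x y ≤ N * δ →
      ∃ p : ℕ → E n, p 0 = x ∧ p N = y ∧ ∀ i < N, realDist a S (p i) (p (i + 1)) ≤ δ := by
  induction N with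
  | zero =>
    intro x hx
    have : dist x y ≤ 0 := (dist_le_realDist ha hS x y).trans (by simpa using hx)
    exact ⟨fun _ => x, rfl, dist_le_zero.1 this, by simp⟩
  | succ N ih =>
    intro x hx
    push_cast at hx
    -- The minimum lets the chain stay at `y` once it has arrived.
    obtain ⟨z, hz, hzy⟩ := exists_realDist_eq_and_le ha hS x y
      (s := min δ (realDist a S x y)) (le_min hδ (realDist_nonneg _ _)) (min_le_right _ _)
    have hzy' : realDist a S z y ≤ N * δ := by
      have hN : 0 ≤ N * δ := by positivity
      rcases min_choice δ (realDist a S x y) with h | h <;> rw [h] at hzy <;> linarith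
    obtain ⟨p, hp0, hpN, hp⟩ := ih z hzy'
    refine ⟨fun i => Nat.casesOn i x p, rfl, hpN, fun i hi => ?_⟩
    cases i with
    | zero => simpa [hp0] using hz.trans_le (min_le_left _ _)
    | succ i => exact hp i (by omega)

theorem realDist_chain_le (ha : 1 ≤ a) (hS : MeasurableSet S) {p : ℕ → E n} {δ : ℝ} {N : ℕ}
    (hp : ∀ i < N, realDist a S (p i) (p (i + 1)) ≤ δ) {i j : ℕ} (hij : i ≤ j) (hj : j ≤ N) :
    realDist a S (p i) (p j) ≤ (j - i : ℝ) * δ := by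
  induction j, hij using Nat.le_induction with
  | base => simp [realDist_self ha hS]
  | succ j hij ih =>
    have h1 := realDist_triangle ha hS (p i) (p j) (p (j + 1))
    have h2 := hp j (by omega)
    have h3 := ih (by omega)
    push_cast
    linarith

/-- Curves with constant speed realising `realDist` between any two of their points. -/
def IsGeodesic {n : ℕ} (a : ℝ) (S : Set (E n)) (f : I → E n) : Prop :=
  ∀ s t : I, realDist a S (f s) (f t) = |(s : ℝ) - t| * realDist a S (f 0) (f 1)

/-- The upper bounds on `[0, s]`, `[s, t]` and `[t, 1]` add up to the distance of the endpoints, so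
the triangle inequality forces equality in each. -/
theorem isGeodesic_of_le (ha : 1 ≤ a) (hS : MeasurableSet S) {f : I → E n}
    (h : ∀ s t : I, s ≤ t →
      realDist a S (f s) (f t) ≤ ((t : ℝ) - s) * realDist a S (f 0) (f 1)) :
    IsGeodesic a S f := by
  have key : ∀ s t : I, s ≤ t →
      realDist a S (f s) (f t) = ((t : ℝ) - s) * realDist a S (f 0) (f 1) := by
    intro s t hst
    refine le_antisymm (h s t hst) ?_
    have h1 := h 0 s unitInterval.nonneg'
    have h2 := h t 1 unitInterval.le_one'
    have h3 := realDist_triangle ha hS (f 0) (f s) (f 1)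
    have h4 := realDist_triangle ha hS (f s) (f t) (f 1)
    simp only [Icc.coe_zero, Icc.coe_one, sub_zero] at h1 h2
    linarith
  intro s t
  rcases le_total s t with hst | hst <;> have hst' := sub_nonneg.2 (Subtype.coe_le_coe.2 hst)
  · rw [key s t hst, abs_sub_comm, abs_of_nonneg hst']
  · rw [realDist_comm hS, key t s hst, abs_of_nonneg hst']

/-- A step function running along a chain of `N + 1` equal steps; rounding the times down accounts
for the error `1 / (N + 1)`. -/
theorem exists_approx_geodesic (ha : 1 ≤ a) (hS : MeasurableSet S) (x y : E n) (N : ℕ) :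
    ∃ f : I → E n, f 0 = x ∧ f 1 = y ∧ ∀ s t : I, s ≤ t →
      realDist a S (f s) (f t) ≤ ((t : ℝ) - s + 1 / ((N : ℝ) + 1)) * realDist a S x y := by
  set D := realDist a S x y with hD
  have hD0 : 0 ≤ D := realDist_nonneg x y
  have hN : (0 : ℝ) < (N : ℝ) + 1 := by positivity
  obtain ⟨p, hp0, hpN, hp⟩ := exists_chain ha hS y (δ := D / ((N : ℝ) + 1)) (by positivity)
    (N + 1) x (by push_cast; rw [← hD]; field_simp; rfl)
  refine ⟨fun t => p ⌊(t : ℝ) * ((N : ℝ) + 1)⌋₊, by simpa using hp0, ?_, fun s t hst => ?_⟩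
  · have : ⌊((1 : I) : ℝ) * ((N : ℝ) + 1)⌋₊ = N + 1 := by
      rw [Icc.coe_one, one_mul]; exact_mod_cast Nat.floor_natCast (N + 1)
    simpa only [this] using hpN
  · have hst' : (s : ℝ) ≤ t := hst
    have h1 : ⌊(s : ℝ) * ((N : ℝ) + 1)⌋₊ ≤ ⌊(t : ℝ) * ((N : ℝ) + 1)⌋₊ :=
      Nat.floor_mono (by gcongr)
    have h2 : ⌊(t : ℝ) * ((N : ℝ) + 1)⌋₊ ≤ N + 1 := by
      apply Nat.floor_le_of_le
      push_cast
      nlinarith [t.2.2]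
    refine (realDist_chain_le ha hS hp h1 h2).trans ?_
    have h3 := Nat.floor_le (mul_nonneg t.2.1 hN.le)
    have h4 := (Nat.lt_floor_add_one ((s : ℝ) * ((N : ℝ) + 1))).le
    have h5 : ((t : ℝ) - s + 1 / ((N : ℝ) + 1)) * D =
        ((t : ℝ) * ((N : ℝ) + 1) - s * ((N : ℝ) + 1) + 1) * (D / ((N : ℝ) + 1)) := by
      field_simp
    rw [h5]
    gcongr
    linarith

theorem tendsto_realDist (ha : 1 ≤ a) (hS : MeasurableSet S) {ι : Type*} {l : Filter ι}
    {u v : ι → E n} {x y : E n} (hu : Tendsto u l (𝓝 x)) (hv : Tendsto v l (𝓝 y)) :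
    Tendsto (fun i => realDist a S (u i) (v i)) l (𝓝 (realDist a S x y)) := by
  have h := (continuous_realDist (a := a) ha hS).tendsto (x, y)
  have h' := h.comp (hu.prodMk_nhds hv)
  exact h'

/-- The step functions stay in a fixed ball, so they converge pointwise along an ultrafilter. The
error vanishes in the limit, and continuity follows from the geodesic identity. -/
theorem exists_isGeodesic (ha : 1 ≤ a) (hS : MeasurableSet S) (x y : E n) :
    ∃ f : I → E n, f 0 = x ∧ f 1 = y ∧ IsGeodesic a S f := by
  choose g hg0 hg1 hg using exists_approx_geodesic (a := a) ha hS x y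
  set D := realDist a S x y with hD
  have hD0 : 0 ≤ D := realDist_nonneg x y
  obtain ⟨U, hU⟩ : ∃ U : Ultrafilter ℕ, (U : Filter ℕ) ≤ atTop := Ultrafilter.exists_le atTop
  have hmem : ∀ t N, g N t ∈ Metric.closedBall x (2 * D) := by
    intro t N
    rw [Metric.mem_closedBall, dist_comm]
    refine (dist_le_realDist ha hS x _).trans ?_
    have := hg N 0 t unitInterval.nonneg'
    rw [hg0] at this
    refine this.trans ?_
    have h1 : 1 / ((N : ℝ) + 1) ≤ 1 := by
      rw [div_le_one (by positivity)]; linarith [(Nat.cast_nonneg N : (0 : ℝ) ≤ N)]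
    have h2 := t.2.2
    gcongr
    simp only [Icc.coe_zero]
    linarith
  have hlim : ∀ t, ∃ z, Tendsto (fun N => g N t) U (𝓝 z) := by
    intro t
    obtain ⟨z, -, hz⟩ := (isCompact_closedBall x (2 * D)).ultrafilter_le_nhds'
      (U.map fun N => g N t) (Ultrafilter.mem_map.2 (univ_mem' (hmem t)))
    exact ⟨z, hz⟩
  choose f hf using hlim
  have hf0 : f 0 = x := tendsto_nhds_unique (hf 0) (by simp only [hg0]; exact tendsto_const_nhds)
  have hf1 : f 1 = y := tendsto_nhds_unique (hf 1) (by simp only [hg1]; exact tendsto_const_nhds)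
  refine ⟨f, hf0, hf1, isGeodesic_of_le ha hS fun s t hst => ?_⟩
  rw [hf0, hf1, ← hD]
  have h1 : Tendsto (fun N => realDist a S (g N s) (g N t)) U (𝓝 (realDist a S (f s) (f t))) :=
    tendsto_realDist ha hS (hf s) (hf t)
  have h2 : Tendsto (fun N : ℕ => ((t : ℝ) - s + 1 / ((N : ℝ) + 1)) * D) U
      (𝓝 (((t : ℝ) - s + 0) * D)) :=
    ((tendsto_one_div_add_atTop_nhds_zero_nat.mono_left hU).const_add _).mul_const _
  rw [add_zero] at h2
  exact le_of_tendsto_of_tendsto' h1 h2 fun N => hg N s t hst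

theorem IsGeodesic.lipschitzWith (ha : 1 ≤ a) (hS : MeasurableSet S) {f : I → E n}
    (hf : IsGeodesic a S f) : LipschitzWith (realDist a S (f 0) (f 1)).toNNReal f := by
  refine LipschitzWith.of_dist_le_mul fun s t => ?_
  rw [Real.coe_toNNReal _ (realDist_nonneg _ _), mul_comm]
  exact (dist_le_realDist ha hS _ _).trans_eq (hf s t)

end Geodesics

/-! ### The cost of a geodesic -/

section GeodesicCost

open Filter Topology

variable {n : ℕ} {a : ℝ} {S : Set (E n)}

theorem liminf_add_liminf_le {u v : ℕ → ℝ≥0∞} {M : ℝ≥0∞} (h : ∀ᶠ k in atTop, u k + v k ≤ M) :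
    liminf u atTop + liminf v atTop ≤ M := by
  rw [liminf_eq_iSup_iInf_of_nat, liminf_eq_iSup_iInf_of_nat,
    ENNReal.iSup_add_iSup_of_monotone
      (fun i j hij => biInf_mono fun k hk => hij.trans hk)
      (fun i j hij => biInf_mono fun k hk => hij.trans hk)]
  refine iSup_le fun m => ?_
  obtain ⟨k, hk, hmk⟩ := (h.and (eventually_ge_atTop m)).exists
  exact (add_le_add (iInf₂_le k hmk) (iInf₂_le k hmk)).trans hk

/-- If the sets `R i` have small overlap with respect to `μ`, so have their intersections with
`A`. -/
theorem sum_measure_inter_le {X ι : Type*} [MeasurableSpace X] (μ : Measure X) (s : Finset ι)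
    (R : ι → Set X) {A : Set X} (hA : MeasurableSet A) {η : ℝ≥0∞}
    (hfin : ∑ i ∈ s, μ (R i) ≠ ⊤) (h : ∑ i ∈ s, μ (R i) ≤ μ (⋃ i ∈ s, R i) + η) :
    ∑ i ∈ s, μ (R i ∩ A) ≤ μ A + η := by
  have hfin' : ∑ i ∈ s, μ (R i \ A) ≠ ⊤ :=
    ne_top_of_le_ne_top hfin (Finset.sum_le_sum fun i _ => measure_mono sdiff_subset)
  -- The parts outside `A` are added on both sides: their sum is finite and dominates the measure of
  -- the union outside `A`.
  rw [← ENNReal.add_le_add_iff_right hfin', ← Finset.sum_add_distrib]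
  simp only [measure_inter_add_sdiff _ hA]
  refine h.trans ?_
  rw [← measure_inter_add_sdiff (⋃ i ∈ s, R i) hA, add_right_comm (μ A)]
  gcongr
  · exact inter_subset_right
  · refine le_trans (measure_mono ?_) (measure_biUnion_finset_le s fun i => R i \ A)
    simp only [iUnion_sdiff]
    exact subset_rfl

theorem exists_concatenation (q : ℕ → E n) (θ : ℕ → LipPath n) (N : ℕ)
    (h0 : ∀ i ≤ N, θ i 0 = q i) (h1 : ∀ i ≤ N, θ i 1 = q (i + 1)) :
    ∃ Θ : LipPath n, Θ 0 = q 0 ∧ Θ 1 = q (N + 1) ∧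
      range Θ ⊆ ⋃ i ∈ Finset.range (N + 1), range (θ i) := by
  induction N with
  | zero => exact ⟨θ 0, h0 0 le_rfl, h1 0 le_rfl, by simp⟩
  | succ N ih =>
    obtain ⟨Θ, hΘ0, hΘ1, hΘ⟩ := ih (fun i hi => h0 i (by omega)) (fun i hi => h1 i (by omega))
    have h : Θ 1 = θ (N + 1) 0 := hΘ1.trans (h0 (N + 1) le_rfl).symm
    refine ⟨Θ.trans (θ (N + 1)), (Θ.trans_zero _ h).trans hΘ0,
      (Θ.trans_one _).trans (h1 _ le_rfl), (Θ.range_trans_subset _ h).trans ?_⟩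
    rw [Finset.range_add_one, Finset.set_biUnion_insert, union_comm]
    exact union_subset_union_right _ hΘ

theorem exists_ediam_image_Icc_le {X : Type*} [PseudoEMetricSpace X] {f : I → X}
    (hf : Continuous f) {u v : I} (huv : u ≤ v) :
    ∃ p q : I, u ≤ p ∧ p ≤ q ∧ q ≤ v ∧ Metric.ediam (f '' Icc u v) ≤ edist (f p) (f q) := by
  have hc : IsCompact (Icc u v ×ˢ Icc u v) := isCompact_Icc.prod isCompact_Icc
  have hF : Continuous fun z : I × I => edist (f z.1) (f z.2) := by fun_prop
  obtain ⟨⟨p, q⟩, ⟨hp, hq⟩, hmax⟩ := hc.exists_isMaxOn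
    ⟨(u, u), ⟨le_rfl, huv⟩, ⟨le_rfl, huv⟩⟩ hF.continuousOn
  have hd : Metric.ediam (f '' Icc u v) ≤ edist (f p) (f q) := by
    refine Metric.ediam_le ?_
    rintro _ ⟨s, hs, rfl⟩ _ ⟨t, ht, rfl⟩
    exact isMaxOn_iff.1 hmax (s, t) ⟨hs, ht⟩
  rcases le_total p q with h | h
  · exact ⟨p, q, hp.1, h, hq.2, hd⟩
  · exact ⟨q, p, hq.1, h, hp.2, by rwa [edist_comm]⟩

theorem exists_path_through (ha : 1 ≤ a) (hS : MeasurableSet S) (w₀ w₁ w₂ w₃ : E n)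
    {κ : ℝ≥0∞} (hκ : κ ≠ 0) :
    ∃ θ : LipPath n, θ 0 = w₀ ∧ θ 1 = w₃ ∧ w₁ ∈ range θ ∧ w₂ ∈ range θ ∧
      costMeasure a S (range θ) ≤
        urbanDist a S w₀ w₁ + urbanDist a S w₁ w₂ + urbanDist a S w₂ w₃ + κ := by
  have hκ' : κ / 3 ≠ 0 := by simpa using hκ
  obtain ⟨θ₁, h10, h11, h1⟩ := exists_path_lt hS
    (ENNReal.lt_add_right (urbanDist_ne_top ha hS w₀ w₁) hκ')
  obtain ⟨θ₂, h20, h21, h2⟩ := exists_path_lt hS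
    (ENNReal.lt_add_right (urbanDist_ne_top ha hS w₁ w₂) hκ')
  obtain ⟨θ₃, h30, h31, h3⟩ := exists_path_lt hS
    (ENNReal.lt_add_right (urbanDist_ne_top ha hS w₂ w₃) hκ')
  have h12 : θ₁ 1 = θ₂ 0 := h11.trans h20.symm
  have h23 : (θ₁.trans θ₂) 1 = θ₃ 0 := (θ₁.trans_one θ₂).trans (h21.trans h30.symm)
  refine ⟨(θ₁.trans θ₂).trans θ₃, ?_, ?_, ?_, ?_, ?_⟩
  · rw [LipPath.trans_zero _ _ h23, LipPath.trans_zero _ _ h12, h10]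
  · rw [LipPath.trans_one, h31]
  · exact LipPath.range_subset_range_trans_left _ _ h23
      (LipPath.range_subset_range_trans_left _ _ h12 ⟨1, h11⟩)
  · exact LipPath.range_subset_range_trans_right _ _ ⟨0, h30⟩
  · refine (measure_mono ((LipPath.range_trans_subset _ _ h23).trans
      (union_subset_union_left _ (LipPath.range_trans_subset _ _ h12)))).trans ?_
    refine (measure_union_le _ _).trans ((add_le_add_left (measure_union_le _ _) _).trans ?_)
    refine (add_le_add (add_le_add h1.le h2.le) h3.le).trans_eq ?_
    conv_rhs => rw [← ENNReal.add_thirds κ]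
    ring

theorem IsGeodesic.urbanDist_eq (ha : 1 ≤ a) (hS : MeasurableSet S) {f : I → E n}
    (hf : IsGeodesic a S f) {u v : I} (huv : u ≤ v) :
    urbanDist a S (f u) (f v) =
      ENNReal.ofReal ((v : ℝ) - u) * urbanDist a S (f 0) (f 1) := by
  have huv' : (0 : ℝ) ≤ v - u := sub_nonneg.2 huv
  rw [← ofReal_realDist ha hS, hf u v, abs_sub_comm, abs_of_nonneg huv',
    ENNReal.ofReal_mul huv', ofReal_realDist ha hS]

/-- Routing the path through two points of the piece at maximal Euclidean distance makes it at least
as long as the diameter. This costs nothing extra, because `d` is additive along the geodesic. -/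
theorem IsGeodesic.exists_path (ha : 1 ≤ a) (hS : MeasurableSet S) {f : I → E n}
    (hf : IsGeodesic a S f) {u v : I} (huv : u ≤ v) {κ : ℝ≥0∞} (hκ : κ ≠ 0) :
    ∃ θ : LipPath n, θ 0 = f u ∧ θ 1 = f v ∧ Metric.ediam (f '' Icc u v) ≤ μH[1] (range θ) ∧
      costMeasure a S (range θ) ≤
        ENNReal.ofReal ((v : ℝ) - u) * urbanDist a S (f 0) (f 1) + κ := by
  obtain ⟨p, q, hup, hpq, hqv, hd⟩ :=
    exists_ediam_image_Icc_le (hf.lipschitzWith ha hS).continuous huv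
  obtain ⟨θ, h0, h1, hp, hq, hc⟩ := exists_path_through ha hS (f u) (f p) (f q) (f v) hκ
  refine ⟨θ, h0, h1, hd.trans
    (edist_le_hausdorffMeasure_of_isPreconnected θ.isPreconnected_range hp hq), hc.trans_eq ?_⟩
  have hup' : (0 : ℝ) ≤ p - u := sub_nonneg.2 hup
  have hpq' : (0 : ℝ) ≤ q - p := sub_nonneg.2 hpq
  have hqv' : (0 : ℝ) ≤ v - q := sub_nonneg.2 hqv
  rw [hf.urbanDist_eq ha hS hup, hf.urbanDist_eq ha hS hpq, hf.urbanDist_eq ha hS hqv,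
    ← add_mul, ← add_mul, ← ENNReal.ofReal_add hup' hpq',
    ← ENNReal.ofReal_add (add_nonneg hup' hpq') hqv']
  rw [show (p : ℝ) - u + (q - p) + (v - q) = v - u by ring]

theorem costMeasure_le_add (ha : 1 ≤ a) (hS : MeasurableSet S) {K : Set (E n)}
    (hK : MeasurableSet K) (A : Set (E n)) :
    costMeasure a K A ≤
      costMeasure a S A + ENNReal.ofReal (a - 1) * μH[1] (A ∩ (S \ K)) := by
  rw [costMeasure_eq_add ha hK, costMeasure_eq_add ha hS, add_assoc, ← mul_add]
  gcongr
  refine le_trans (measure_mono ?_) (measure_union_le _ _)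
  intro z hz
  by_cases h : z ∈ S
  · exact Or.inr ⟨hz.1, h, hz.2⟩
  · exact Or.inl ⟨hz.1, h⟩

/-- The equidistant times `i / (N + 1)`. -/
noncomputable def gridTime (N i : ℕ) : I := projIcc 0 1 zero_le_one ((i : ℝ) / ((N : ℝ) + 1))

theorem coe_gridTime {N i : ℕ} (hi : i ≤ N + 1) :
    (gridTime N i : ℝ) = (i : ℝ) / ((N : ℝ) + 1) := by
  have hi' : (i : ℝ) ≤ (N : ℝ) + 1 := by exact_mod_cast hi
  rw [gridTime, projIcc_of_mem zero_le_one
    ⟨by positivity, (div_le_one (by positivity)).2 hi'⟩]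

theorem monotone_gridTime (N : ℕ) : Monotone (gridTime N) := fun i j hij =>
  monotone_projIcc zero_le_one (by gcongr)

theorem gridTime_succ_sub {N i : ℕ} (hi : i ≤ N) :
    (gridTime N (i + 1) : ℝ) - gridTime N i = 1 / ((N : ℝ) + 1) := by
  rw [coe_gridTime (by omega), coe_gridTime (by omega)]
  push_cast
  ring

theorem exists_mem_Icc_gridTime (N : ℕ) (t : I) :
    ∃ i < N + 1, t ∈ Icc (gridTime N i) (gridTime N (i + 1)) := by
  have hN : (0 : ℝ) < (N : ℝ) + 1 := by positivity
  rcases eq_or_lt_of_le (unitInterval.le_one' (t := t)) with rfl | ht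
  · refine ⟨N, by omega, unitInterval.le_one', ?_⟩
    rw [← Subtype.coe_le_coe, coe_gridTime le_rfl]
    push_cast
    rw [div_self hN.ne']
  · have h1 := Nat.floor_le (mul_nonneg t.2.1 hN.le)
    have h2 := (Nat.lt_floor_add_one ((t : ℝ) * ((N : ℝ) + 1))).le
    have h3 : ⌊(t : ℝ) * ((N : ℝ) + 1)⌋₊ < N + 1 := by
      rw [Nat.floor_lt (mul_nonneg t.2.1 hN.le)]
      push_cast
      have : (t : ℝ) < 1 := ht
      nlinarith
    refine ⟨_, h3, ?_, ?_⟩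
    · rw [← Subtype.coe_le_coe, coe_gridTime (by omega), div_le_iff₀ hN]
      exact h1
    · rw [← Subtype.coe_le_coe, coe_gridTime (by omega), le_div_iff₀ hN]
      push_cast
      exact h2

/-- Lower bound for the length of a geodesic in terms of the Euclidean diameters of its pieces;
the pieces with index in `P`, far from `K ⊆ S`, are weighted by `a`. -/
theorem IsGeodesic.sum_ediam_le (ha : 1 ≤ a) (hS : MeasurableSet S) {f : I → E n}
    (hf : IsGeodesic a S f) {K : Set (E n)} (hK : MeasurableSet K) {η : ℝ≥0∞} (hη : η ≠ 0)
    (hη1 : η ≤ 1) (N : ℕ) {P : Finset ℕ} (hPN : P ⊆ Finset.range (N + 1))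
    (hP : ∀ i ∈ P, ∀ z, edist (f (gridTime N i)) z ≤
      ENNReal.ofReal (1 / ((N : ℝ) + 1)) * (urbanDist a S (f 0) (f 1) + 1) → z ∉ K) :
    ∑ i ∈ Finset.range (N + 1), Metric.ediam (f '' Icc (gridTime N i) (gridTime N (i + 1))) +
      ENNReal.ofReal (a - 1) *
        ∑ i ∈ P, Metric.ediam (f '' Icc (gridTime N i) (gridTime N (i + 1))) ≤
    urbanDist a S (f 0) (f 1) + η + ENNReal.ofReal (a - 1) * (μH[1] (S \ K) + η) := by
  set D := urbanDist a S (f 0) (f 1) with hD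
  have hDtop : D ≠ ⊤ := urbanDist_ne_top ha hS _ _
  have hηtop : η ≠ ⊤ := ne_top_of_le_ne_top ENNReal.one_ne_top hη1
  have hN : (0 : ℝ) < (N : ℝ) + 1 := by positivity
  set h := ENNReal.ofReal (1 / ((N : ℝ) + 1)) with hh
  have hh0 : h ≠ 0 := by rw [hh]; simpa using hN
  have hsum : ∑ _i ∈ Finset.range (N + 1), h = 1 := by
    rw [Finset.sum_const, Finset.card_range, nsmul_eq_mul, hh, one_div,
      ENNReal.ofReal_inv_of_pos hN, ← Nat.cast_succ, ENNReal.ofReal_natCast]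
    exact ENNReal.mul_inv_cancel (by simp) (ENNReal.natCast_ne_top _)
  have hex : ∀ i, ∃ θ : LipPath n, i ≤ N → θ 0 = f (gridTime N i) ∧
      θ 1 = f (gridTime N (i + 1)) ∧
      Metric.ediam (f '' Icc (gridTime N i) (gridTime N (i + 1))) ≤ μH[1] (range θ) ∧
      costMeasure a S (range θ) ≤ h * D + h * η := by
    intro i
    obtain ⟨θ, hθ⟩ := hf.exists_path ha hS (monotone_gridTime N (Nat.le_succ i))
      (mul_ne_zero hh0 hη)
    refine ⟨θ, fun hi => ?_⟩
    rwa [gridTime_succ_sub hi] at hθ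
  choose θ hθ using hex
  have hcost : ∑ i ∈ Finset.range (N + 1), costMeasure a S (range (θ i)) ≤ D + η := by
    calc _ ≤ ∑ i ∈ Finset.range (N + 1), h * (D + η) := by
          refine Finset.sum_le_sum fun i hi => ?_
          rw [mul_add]
          exact (hθ i (by simpa [Nat.lt_succ_iff] using hi)).2.2.2
      _ = D + η := by rw [← Finset.sum_mul, hsum, one_mul]
  -- The concatenated path competes in the infimum defining `D`. Together with `hcost` this limits
  -- the total overlap to `η`.
  have hDle : D ≤ costMeasure a S (⋃ i ∈ Finset.range (N + 1), range (θ i)) := by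
    obtain ⟨Θ, h0, h1, hΘ⟩ := exists_concatenation (fun i => f (gridTime N i)) θ N
      (fun i hi => (hθ i hi).1) (fun i hi => (hθ i hi).2.1)
    have e0 : gridTime N 0 = 0 := by
      apply Subtype.ext
      rw [coe_gridTime (by omega)]
      simp
    have e1 : gridTime N (N + 1) = 1 := by
      apply Subtype.ext
      rw [coe_gridTime le_rfl]
      push_cast
      rw [div_self hN.ne']
    exact urbanDist_le_of_range_subset hS Θ (by rw [h0, e0]) (by rw [h1, e1]) hΘ
  have hover : ∑ i ∈ Finset.range (N + 1), μH[1] (range (θ i) ∩ (S \ K)) ≤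
      μH[1] (S \ K) + η := by
    have h1 := sum_measure_inter_le (costMeasure a S) (Finset.range (N + 1))
      (fun i => range (θ i)) (hS.diff hK) (η := η)
      (ne_top_of_le_ne_top (ENNReal.add_ne_top.2 ⟨hDtop, hηtop⟩) hcost)
      (hcost.trans (add_le_add_left hDle η))
    have h2 : costMeasure a S (S \ K) = μH[1] (S \ K) := by
      rw [costMeasure_eq_add ha hS, sdiff_eq_empty.2 sdiff_subset]
      simp
    rw [h2] at h1
    exact (Finset.sum_le_sum fun i _ => hausdorffMeasure_le_costMeasure ha hS _).trans h1
  -- A connected image does not reach further than its length, which is at most `h * (D + η) ≤ h *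
  -- (D + 1)`, the radius in `hP`.
  have hfar : ∀ i ∈ P, range (θ i) \ K = range (θ i) := by
    intro i hi
    have hiN : i ≤ N := by simpa [Nat.lt_succ_iff] using hPN hi
    obtain ⟨h0, -, -, hc⟩ := hθ i hiN
    refine sdiff_eq_left.2 (disjoint_left.2 fun z hz => hP i hi z ?_)
    refine (edist_le_hausdorffMeasure_of_isPreconnected (θ i).isPreconnected_range
      ⟨0, h0⟩ hz).trans ((hausdorffMeasure_le_costMeasure ha hS _).trans (hc.trans ?_))
    rw [← mul_add]
    gcongr
  calc _ ≤ ∑ i ∈ Finset.range (N + 1), μH[1] (range (θ i)) +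
        ENNReal.ofReal (a - 1) * ∑ i ∈ Finset.range (N + 1), μH[1] (range (θ i) \ K) := by
        gcongr ?_ + _ * ?_
        · exact Finset.sum_le_sum fun i hi =>
            (hθ i (by simpa [Nat.lt_succ_iff] using hi)).2.2.1
        · calc _ ≤ ∑ i ∈ P, μH[1] (range (θ i) \ K) := by
                refine Finset.sum_le_sum fun i hi => ?_
                rw [hfar i hi]
                exact (hθ i (by simpa [Nat.lt_succ_iff] using hPN hi)).2.2.1
            _ ≤ _ := Finset.sum_le_sum_of_subset hPN
    _ = ∑ i ∈ Finset.range (N + 1), costMeasure a K (range (θ i)) := by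
        rw [Finset.mul_sum, ← Finset.sum_add_distrib]
        exact Finset.sum_congr rfl fun i _ => (costMeasure_eq_add ha hK _).symm
    _ ≤ ∑ i ∈ Finset.range (N + 1), (costMeasure a S (range (θ i)) +
        ENNReal.ofReal (a - 1) * μH[1] (range (θ i) ∩ (S \ K))) :=
        Finset.sum_le_sum fun i _ => costMeasure_le_add ha hS hK _
    _ ≤ _ := by
        rw [Finset.sum_add_distrib, ← Finset.mul_sum]
        gcongr

theorem IsGeodesic.ediam_piece_le (ha : 1 ≤ a) (hS : MeasurableSet S) {f : I → E n}
    (hf : IsGeodesic a S f) {N i : ℕ} (hi : i ≤ N) :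
    Metric.ediam (f '' Icc (gridTime N i) (gridTime N (i + 1))) ≤
      ENNReal.ofReal (1 / ((N : ℝ) + 1)) * urbanDist a S (f 0) (f 1) := by
  refine Metric.ediam_le ?_
  have key : ∀ s ∈ Icc (gridTime N i) (gridTime N (i + 1)),
      ∀ t ∈ Icc (gridTime N i) (gridTime N (i + 1)), s ≤ t →
      edist (f s) (f t) ≤ ENNReal.ofReal (1 / ((N : ℝ) + 1)) * urbanDist a S (f 0) (f 1) := by
    intro s hs t ht hst
    refine (edist_le_urbanDist ha hS _ _).trans ((hf.urbanDist_eq ha hS hst).trans_le ?_)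
    gcongr
    rw [← gridTime_succ_sub hi]
    have h1 : (t : ℝ) ≤ gridTime N (i + 1) := ht.2
    have h2 : (gridTime N i : ℝ) ≤ s := hs.1
    linarith
  rintro _ ⟨s, hs, rfl⟩ _ ⟨t, ht, rfl⟩
  rcases le_total s t with h | h
  · exact key s hs t ht h
  · rw [edist_comm]
    exact key t ht s hs h

theorem tendsto_ofReal_one_div_mul {c : ℝ≥0∞} (hc : c ≠ ⊤) :
    Tendsto (fun N : ℕ => ENNReal.ofReal (1 / ((N : ℝ) + 1)) * c) atTop (𝓝 0) := by
  have h := ENNReal.Tendsto.mul_const (b := c)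
    (ENNReal.tendsto_ofReal tendsto_one_div_add_atTop_nhds_zero_nat) (Or.inr hc)
  simpa using h

/-- The limit of `sum_ediam_le` under refinement: the pieces cover `range f`, those leaving the
thickening cover the rest of `range f` outside it, and their diameters tend to zero. -/
theorem IsGeodesic.hausdorffMeasure_add_le (ha : 1 ≤ a) (hS : MeasurableSet S) {f : I → E n}
    (hf : IsGeodesic a S f) {K : Set (E n)} (hK : IsClosed K) {η : ℝ≥0∞} (hη : η ≠ 0)
    (hη1 : η ≤ 1) {ρ : ℝ} (hρ : 0 < ρ) :
    μH[1] (range f) + ENNReal.ofReal (a - 1) * μH[1] (range f \ Metric.thickening ρ K) ≤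
    urbanDist a S (f 0) (f 1) + η + ENNReal.ofReal (a - 1) * (μH[1] (S \ K) + η) := by
  classical
  set D := urbanDist a S (f 0) (f 1) with hD
  have hDtop : D ≠ ⊤ := urbanDist_ne_top ha hS _ _
  let J : ℕ → ℕ → Set (E n) := fun N i => f '' Icc (gridTime N i) (gridTime N (i + 1))
  let P : ℕ → Finset ℕ := fun N =>
    (Finset.range (N + 1)).filter fun i => (J N i ∩ (Metric.thickening ρ K)ᶜ).Nonempty
  have hr := tendsto_ofReal_one_div_mul hDtop
  have hJ : ∀ N, ∀ i ≤ N, Metric.ediam (J N i) ≤ ENNReal.ofReal (1 / ((N : ℝ) + 1)) * D :=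
    fun N i hi => hf.ediam_piece_le ha hS hi
  have h1 : μH[1] (range f) ≤
      liminf (fun N => ∑ i ∈ Finset.range (N + 1), Metric.ediam (J N i)) atTop := by
    have := Measure.hausdorffMeasure_le_liminf_sum (ι := fun N => Finset.range (N + 1)) 1
      (range f) _ hr (fun N i => J N i)
      (Eventually.of_forall fun N i => hJ N i (Nat.lt_succ_iff.1 (Finset.mem_range.1 i.2)))
      (Eventually.of_forall fun N => by
        rintro _ ⟨t, rfl⟩
        obtain ⟨i, hi, ht⟩ := exists_mem_Icc_gridTime N t
        exact mem_iUnion.2 ⟨⟨i, Finset.mem_range.2 hi⟩, t, ht, rfl⟩)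
    simp only [ENNReal.rpow_one] at this
    convert this using 3 with N
    exact (Finset.sum_coe_sort (Finset.range (N + 1)) fun i => Metric.ediam (J N i)).symm
  have h2 : μH[1] (range f \ Metric.thickening ρ K) ≤
      liminf (fun N => ∑ i ∈ P N, Metric.ediam (J N i)) atTop := by
    have := Measure.hausdorffMeasure_le_liminf_sum (ι := fun N => P N) 1
      (range f \ Metric.thickening ρ K) _ hr (fun N i => J N i)
      (Eventually.of_forall fun N i => hJ N i
        (by simpa [Nat.lt_succ_iff] using (Finset.mem_filter.1 i.2).1))
      (Eventually.of_forall fun N => by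
        rintro _ ⟨⟨t, rfl⟩, ht'⟩
        obtain ⟨i, hi, ht⟩ := exists_mem_Icc_gridTime N t
        exact mem_iUnion.2 ⟨⟨i, Finset.mem_filter.2
          ⟨Finset.mem_range.2 hi, f t, ⟨t, ht, rfl⟩, ht'⟩⟩, t, ht, rfl⟩)
    simp only [ENNReal.rpow_one] at this
    convert this using 3 with N
    exact (Finset.sum_coe_sort (P N) fun i => Metric.ediam (J N i)).symm
  refine le_trans (add_le_add h1 (mul_le_mul_right h2 _)) ?_
  rw [← ENNReal.liminf_const_mul_of_ne_top ENNReal.ofReal_ne_top]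
  refine liminf_add_liminf_le ?_
  -- For large `N` the diameter of a piece plus the reach of its replacement path is below `ρ`, so a
  -- piece with a point outside the thickening has a replacement missing `K`.
  have hr' := (hr.add (tendsto_ofReal_one_div_mul
    (ENNReal.add_ne_top.2 ⟨hDtop, ENNReal.one_ne_top⟩))).eventually_lt_const
    (u := ENNReal.ofReal ρ) (by simpa using hρ)
  filter_upwards [hr'] with N hN
  refine hf.sum_ediam_le ha hS hK.measurableSet hη hη1 N (Finset.filter_subset _ _) ?_
  intro i hi z hz hzK
  obtain ⟨hiN, w, hw, hwK⟩ := Finset.mem_filter.1 hi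
  refine hwK ((Metric.mem_thickening_iff_exists_edist_lt _ _).2 ⟨z, hzK, lt_of_le_of_lt ?_ hN⟩)
  refine (edist_triangle w (f (gridTime N i)) z).trans (add_le_add ?_ hz)
  exact (Metric.edist_le_ediam_of_mem hw ⟨_, ⟨le_rfl, monotone_gridTime N (Nat.le_succ i)⟩,
    rfl⟩).trans (hJ N i (by simpa [Nat.lt_succ_iff] using hiN))

/-- Finiteness of `μH[1] S` gives inner approximation of `S` by compact `K`. As `K` is closed, its
shrinking thickenings exhaust the complement of `K`, so `ρ` can be sent to zero. -/
theorem IsGeodesic.costMeasure_range_le (ha : 1 ≤ a) (hS : MeasurableSet S)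
    (hSfin : μH[1] S < ⊤) {f : I → E n} (hf : IsGeodesic a S f) :
    costMeasure a S (range f) ≤ urbanDist a S (f 0) (f 1) := by
  set D := urbanDist a S (f 0) (f 1) with hD
  set c := ENNReal.ofReal (a - 1) with hc
  have key : ∀ η : ℝ≥0∞, η ≠ 0 → η ≤ 1 →
      costMeasure a S (range f) ≤ D + (η + c * (η + η)) := by
    intro η hη hη1
    have : IsFiniteMeasure (μH[1].restrict S : Measure (E n)) :=
      ⟨by rwa [Measure.restrict_apply_univ]⟩
    obtain ⟨K, hKS, hK, hKη⟩ := hS.exists_isCompact_sdiff_lt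
      (μ := μH[1].restrict S) (measure_ne_top _ _) hη
    rw [Measure.restrict_apply' hS, inter_eq_left.2 sdiff_subset] at hKη
    have hun : range f \ K = ⋃ k : ℕ, range f \ Metric.thickening (1 / ((k : ℝ) + 1)) K := by
      ext z
      simp only [mem_iUnion, Set.mem_sdiff]
      constructor
      · rintro ⟨hz, hzK⟩
        obtain ⟨ε, hε, hball⟩ := Metric.isOpen_iff.1 hK.isClosed.isOpen_compl z hzK
        obtain ⟨k, hk⟩ := exists_nat_one_div_lt hε
        refine ⟨k, hz, fun h => ?_⟩
        obtain ⟨w, hw, hzw⟩ := Metric.mem_thickening_iff.1 h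
        exact hball (by rw [Metric.mem_ball, dist_comm]; exact hzw.trans hk) hw
      · rintro ⟨k, hz, hzK⟩
        exact ⟨hz, fun h => hzK (Metric.self_subset_thickening (by positivity) K h)⟩
    have hmono : Monotone fun k : ℕ => range f \ Metric.thickening (1 / ((k : ℝ) + 1)) K := by
      intro k l hkl
      refine sdiff_subset_sdiff_right (Metric.thickening_mono ?_ K)
      exact Nat.one_div_le_one_div hkl
    calc costMeasure a S (range f) ≤ μH[1] (range f) + c * μH[1] (range f \ K) := by
          rw [costMeasure_eq_add ha hS]
          gcongr
      _ = ⨆ k : ℕ, (μH[1] (range f) +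
          c * μH[1] (range f \ Metric.thickening (1 / ((k : ℝ) + 1)) K)) := by
          rw [hun, hmono.measure_iUnion, ENNReal.mul_iSup, ENNReal.add_iSup]
      _ ≤ D + η + c * (μH[1] (S \ K) + η) := iSup_le fun k =>
          hf.hausdorffMeasure_add_le ha hS hK.isClosed hη hη1 (by positivity)
      _ ≤ D + η + c * (η + η) := by gcongr
      _ = _ := add_assoc _ _ _
  refine ENNReal.le_of_forall_pos_le_add fun ε hε _ => ?_
  have hlim : Tendsto (fun η : ℝ≥0∞ => η + c * (η + η)) (𝓝 0) (𝓝 (0 + c * (0 + 0))) :=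
    tendsto_id.add (ENNReal.Tendsto.const_mul (tendsto_id.add tendsto_id)
      (Or.inr ENNReal.ofReal_ne_top))
  have hev : ∀ᶠ η : ℝ≥0∞ in 𝓝[>] 0, η + c * (η + η) < ε :=
    (hlim.mono_left nhdsWithin_le_nhds).eventually_lt_const (by simpa using hε)
  have hev1 : ∀ᶠ η : ℝ≥0∞ in 𝓝[>] 0, η < 1 :=
    nhdsWithin_le_nhds (Iio_mem_nhds one_pos)
  obtain ⟨η, ⟨h1, h2⟩, h3⟩ := ((hev.and hev1).and self_mem_nhdsWithin).exists
  exact (key η (ne_of_gt h3) h2.le).trans (by gcongr)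

end GeodesicCost

/-! ### Lifting and minimisation of measures on compact spaces -/

section Measures

open Filter Topology

/-- Finite measures can be lifted along continuous surjections between compact spaces. -/
theorem exists_finiteMeasure_map_eq {G Z : Type*} [TopologicalSpace G] [CompactSpace G]
    [T2Space G] [MeasurableSpace G] [BorelSpace G] [MetricSpace Z] [SecondCountableTopology Z]
    [MeasurableSpace Z] [BorelSpace Z] {p : G → Z} (hp : Continuous p)
    (hsurj : Function.Surjective p) (γ : FiniteMeasure Z) :
    ∃ η : FiniteMeasure G, η.map p = γ := by
  have hclosed : IsClosed ((fun η : FiniteMeasure G => η.map p) '' {η | η.mass = γ.mass}) :=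
    ((isCompact_setOfPred_finiteMeasure_eq_of_compactSpace G γ.mass).image
      (FiniteMeasure.continuous_map hp)).isClosed
  have hid : StronglyMeasurable (id : Z → Z) := measurable_id.stronglyMeasurable
  -- The section `s` need not be measurable, but its composition with a simple function is. So the
  -- push-forwards of `γ` under simple approximations of the identity lift, and the closed set of
  -- liftable measures contains their weak limit.
  obtain ⟨s, hs⟩ := hsurj.hasRightInverse
  have hmem : ∀ k, γ.map (hid.approx k) ∈
      (fun η : FiniteMeasure G => η.map p) '' {η | η.mass = γ.mass} := by
    intro k
    have hm : Measurable (s ∘ hid.approx k) := ((hid.approx k).map s).measurable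
    refine ⟨γ.map (s ∘ hid.approx k), ?_, ?_⟩
    · simp only [mem_ofPred_eq, FiniteMeasure.mass]
      rw [FiniteMeasure.map_apply γ hm MeasurableSet.univ, preimage_univ]
    · apply FiniteMeasure.toMeasure_injective
      simp only [FiniteMeasure.toMeasure_map]
      rw [Measure.map_map hp.measurable hm, ← Function.comp_assoc, hs.comp_eq_id]
      rfl
  have hlim : Tendsto (fun k => γ.map (hid.approx k)) atTop (𝓝 γ) := by
    refine FiniteMeasure.tendsto_of_forall_integral_tendsto fun f => ?_
    have h1 : ∀ k, ∫ z, f z ∂(γ.map (hid.approx k) : Measure Z) =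
        ∫ z, f (hid.approx k z) ∂(γ : Measure Z) := by
      intro k
      rw [FiniteMeasure.toMeasure_map, integral_map (hid.approx k).measurable.aemeasurable
        f.continuous.aestronglyMeasurable]
    simp only [h1]
    refine tendsto_integral_of_dominated_convergence (fun _ => ‖f‖) (fun k => ?_)
      (integrable_const _) (fun k => Eventually.of_forall fun z => f.norm_coe_le_norm _)
      (Eventually.of_forall fun z => ?_)
    · exact (f.continuous.measurable.comp (hid.approx k).measurable).aestronglyMeasurable
    · exact (f.continuous.tendsto z).comp (hid.tendsto_approx z)
  obtain ⟨η, -, hη⟩ := hclosed.mem_of_tendsto hlim (Eventually.of_forall hmem)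
  exact ⟨η, hη⟩

/-- Measures of fixed mass on a compact space are weakly compact, the marginal constraints are
closed, and the integral of a continuous cost is weakly continuous. -/
theorem exists_minimiser_of_marginals {G X Y : Type*} [TopologicalSpace G] [CompactSpace G]
    [T2Space G] [MeasurableSpace G] [BorelSpace G]
    [TopologicalSpace X] [MeasurableSpace X] [BorelSpace X] [HasOuterApproxClosed X]
    [TopologicalSpace Y] [MeasurableSpace Y] [BorelSpace Y] [HasOuterApproxClosed Y]
    {e₀ : G → X} {e₁ : G → Y} (h₀ : Continuous e₀) (h₁ : Continuous e₁)
    (μ : FiniteMeasure X) (ν : FiniteMeasure Y) (c : C(G, ℝ≥0))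
    (hne : ∃ η : FiniteMeasure G, η.map e₀ = μ ∧ η.map e₁ = ν) :
    ∃ η : FiniteMeasure G, (η.map e₀ = μ ∧ η.map e₁ = ν) ∧
      ∀ η' : FiniteMeasure G, η'.map e₀ = μ → η'.map e₁ = ν →
        ∫⁻ g, c g ∂(η : Measure G) ≤ ∫⁻ g, c g ∂(η' : Measure G) := by
  have hcl : IsClosed {η : FiniteMeasure G | η.map e₀ = μ ∧ η.map e₁ = ν} :=
    (isClosed_eq (FiniteMeasure.continuous_map h₀) continuous_const).inter
      (isClosed_eq (FiniteMeasure.continuous_map h₁) continuous_const)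
  have hC : IsCompact {η : FiniteMeasure G | η.map e₀ = μ ∧ η.map e₁ = ν} := by
    refine (isCompact_setOfPred_finiteMeasure_eq_of_compactSpace G μ.mass).of_isClosed_subset
      hcl ?_
    rintro η ⟨hη, -⟩
    simp only [mem_ofPred_eq, ← hη, FiniteMeasure.mass]
    rw [FiniteMeasure.map_apply η h₀.measurable MeasurableSet.univ, preimage_univ]
  obtain ⟨η, hη, hmin⟩ := hC.exists_isMinOn hne
    (FiniteMeasure.continuous_lintegral_continuousMap c).continuousOn
  exact ⟨η, hη, fun η' h h' => isMinOn_iff.1 hmin η' ⟨h, h'⟩⟩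

end Measures

/-! ### Measurability of the endpoint evaluations -/

namespace LipPath

variable {n : ℕ}

/-- Increasing bijections of `I` fix its endpoints, so evaluation there is 1-Lipschitz for `d_Θ`. -/
theorem dist_zero_le (θ₁ θ₂ : LipPath n) : dist (θ₁ 0) (θ₂ 0) ≤ dist θ₁ θ₂ := by
  refine le_ciInf fun φ => ?_
  have h : φ 0 = 0 := φ.map_bot
  simpa only [h] using le_supDist θ₁ θ₂ φ 0

theorem dist_one_le (θ₁ θ₂ : LipPath n) : dist (θ₁ 1) (θ₂ 1) ≤ dist θ₁ θ₂ := by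
  refine le_ciInf fun φ => ?_
  have h : φ 1 = 1 := φ.map_top
  simpa only [h] using le_supDist θ₁ θ₂ φ 1

theorem measurable_eval_zero : Measurable fun θ : LipPath n => θ 0 :=
  (LipschitzWith.of_dist_le_mul (K := 1) fun θ₁ θ₂ => by
    simpa using dist_zero_le θ₁ θ₂).continuous.measurable

theorem measurable_eval_one : Measurable fun θ : LipPath n => θ 1 :=
  (LipschitzWith.of_dist_le_mul (K := 1) fun θ₁ θ₂ => by
    simpa using dist_one_le θ₁ θ₂).continuous.measurable

end LipPath

/-! ### Loop-freeness and compactness of geodesics -/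

section Geodesics

variable {n : ℕ} {a : ℝ} {S : Set (E n)}

/-- A curve that agrees with a geodesic up to reparameterisation has no loop. -/
theorem LipPath.loopFree_of_inseparable (ha : 1 ≤ a) (hS : MeasurableSet S) {θ g : LipPath n}
    (hg : IsGeodesic a S g) (h : Inseparable θ g) : θ.LoopFree := by
  rintro ⟨t₁, t₂, t₃, h12, h23, h13, hne⟩
  refine hne (dist_le_zero.1 (le_of_forall_pos_le_add fun ε hε => ?_))
  rw [zero_add]
  have h0 : LipPath.pathDist θ g = 0 := Metric.inseparable_iff.1 h
  have ha0 : 0 < a := by linarith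
  -- With closeness `δ`, equal values of `θ` at `t₁` and `t₃` put those of `g ∘ φ` within `2δ`,
  -- hence within `2aδ` in `d`, and the intermediate value is no further away. Returning to `θ`
  -- costs another `2δ`.
  obtain ⟨φ, hφ⟩ : ∃ φ, LipPath.supDist θ g φ < ε / (2 + 2 * a) :=
    exists_lt_of_ciInf_lt (h0.trans_lt (by positivity))
  have hδ : ε / (2 + 2 * a) * (2 + 2 * a) = ε := by field_simp
  have hclose : ∀ t, dist (θ t) (g (φ t)) ≤ ε / (2 + 2 * a) := fun t =>
    (LipPath.le_supDist θ g φ t).trans hφ.le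
  set δ := ε / (2 + 2 * a) with hδ'
  have e13 : dist (g (φ t₁)) (g (φ t₃)) ≤ 2 * δ := by
    have := dist_triangle_left (g (φ t₁)) (g (φ t₃)) (θ t₁)
    have h3 := hclose t₃
    rw [← h13] at h3
    linarith [hclose t₁]
  have e12 : dist (g (φ t₂)) (g (φ t₁)) ≤ a * (2 * δ) := by
    have i12 : (φ t₁ : ℝ) ≤ φ t₂ := φ.monotone h12.le
    have i23 : (φ t₂ : ℝ) ≤ φ t₃ := φ.monotone h23.le
    calc dist (g (φ t₂)) (g (φ t₁)) ≤ realDist a S (g (φ t₂)) (g (φ t₁)) :=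
          dist_le_realDist ha hS _ _
      _ = |(φ t₂ : ℝ) - φ t₁| * realDist a S (g 0) (g 1) := hg _ _
      _ ≤ |(φ t₁ : ℝ) - φ t₃| * realDist a S (g 0) (g 1) := by
          refine mul_le_mul_of_nonneg_right ?_ (realDist_nonneg _ _)
          rw [abs_of_nonneg (by linarith), abs_sub_comm, abs_of_nonneg (by linarith)]
          linarith
      _ = realDist a S (g (φ t₁)) (g (φ t₃)) := (hg _ _).symm
      _ ≤ a * dist (g (φ t₁)) (g (φ t₃)) := realDist_le ha hS _ _
      _ ≤ a * (2 * δ) := by gcongr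
  have h4 := dist_triangle4 (θ t₂) (g (φ t₂)) (g (φ t₁)) (θ t₁)
  have h5 := hclose t₁
  rw [dist_comm] at h5
  linarith [hclose t₂]

/-- The geodesics from `A` to `B`. -/
def geodesicSet {n : ℕ} (a : ℝ) (S A B : Set (E n)) : Set C(I, E n) :=
  {f | f 0 ∈ A ∧ f 1 ∈ B ∧ IsGeodesic a S f}

/-- Arzelà–Ascoli: the distances between `A` and `B` bound all Lipschitz constants, and the geodesic
identity survives pointwise limits because `d` is continuous. -/
theorem isCompact_geodesicSet (ha : 1 ≤ a) (hS : MeasurableSet S) {A B : Set (E n)}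
    (hA : IsCompact A) (hB : IsCompact B) : IsCompact (geodesicSet a S A B) := by
  obtain ⟨D, hD⟩ : ∃ D, ∀ x ∈ A, ∀ y ∈ B, realDist a S x y ≤ D := by
    obtain ⟨D, hD⟩ := (hA.prod hB).bddAbove_image (continuous_realDist (a := a) ha hS).continuousOn
    exact ⟨D, fun x hx y hy => hD ⟨(x, y), ⟨hx, hy⟩, rfl⟩⟩
  obtain ⟨R, hR⟩ := hA.isBounded.subset_closedBall (0 : E n)
  refine ArzelaAscoli.isCompact_of_equicontinuous _ ?_ ?_
  · have heq : ContinuousMap.toFun '' geodesicSet a S A B =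
        {f : I → E n | f 0 ∈ A ∧ f 1 ∈ B ∧ IsGeodesic a S f} := by
      ext f
      constructor
      · rintro ⟨g, hg, rfl⟩
        exact hg
      · intro hf
        exact ⟨⟨f, (hf.2.2.lipschitzWith ha hS).continuous⟩, hf, rfl⟩
    rw [heq]
    refine (isCompact_univ_pi fun _ : I =>
      isCompact_closedBall (0 : E n) (D + R)).of_isClosed_subset ?_ ?_
    · refine (hA.isClosed.preimage (continuous_apply 0)).inter
        ((hB.isClosed.preimage (continuous_apply 1)).inter ?_)
      have : {f : I → E n | IsGeodesic a S f} = ⋂ (s : I) (t : I), {f : I → E n |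
          realDist a S (f s) (f t) = |(s : ℝ) - t| * realDist a S (f 0) (f 1)} := by
        ext f
        simp only [mem_iInter]
        rfl
      change IsClosed {f : I → E n | IsGeodesic a S f}
      rw [this]
      refine isClosed_iInter fun s => isClosed_iInter fun t => isClosed_eq ?_ ?_
      · exact continuous_realDist_comp ha hS (continuous_apply s) (continuous_apply t)
      · exact continuous_const.mul
          (continuous_realDist_comp ha hS (continuous_apply 0) (continuous_apply 1))
    · rintro f ⟨h0, h1, hf⟩ t -
      have e1 : dist (f t) (f 0) ≤ D := by
        refine (dist_le_realDist ha hS _ _).trans ((hf t 0).trans_le ?_)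
        refine le_trans ?_ (hD _ h0 _ h1)
        refine mul_le_of_le_one_left (realDist_nonneg _ _) ?_
        rw [Icc.coe_zero, sub_zero, abs_of_nonneg t.2.1]
        exact t.2.2
      have e2 : dist (f 0) 0 ≤ R := hR h0
      exact (dist_triangle _ _ _).trans (add_le_add e1 e2)
  · refine (LipschitzWith.uniformEquicontinuous _ D.toNNReal fun f => ?_).equicontinuous
    obtain ⟨f, h0, h1, hf⟩ := f
    exact (hf.lipschitzWith ha hS).weaken (Real.toNNReal_le_toNNReal (hD _ h0 _ h1))

/-- A geodesic as an element of `LipPath n`. -/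
noncomputable def geodesicPath (ha : 1 ≤ a) (hS : MeasurableSet S) {A B : Set (E n)}
    (g : geodesicSet a S A B) : LipPath n where
  toFun := g.1
  lipschitz := ⟨_, g.2.2.2.lipschitzWith ha hS⟩

theorem continuous_geodesicPath (ha : 1 ≤ a) (hS : MeasurableSet S) {A B : Set (E n)} :
    Continuous (geodesicPath ha hS : geodesicSet a S A B → LipPath n) := by
  refine (LipschitzWith.of_dist_le_mul (K := 1) fun g h => ?_).continuous
  rw [NNReal.coe_one, one_mul]
  refine (LipPath.pathDist_le _ _ (OrderIso.refl I)).trans (ciSup_le fun t => ?_)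
  exact ContinuousMap.dist_apply_le_dist t

theorem pathCost_geodesicPath_le (ha : 1 ≤ a) (hS : MeasurableSet S) (hSfin : μH[1] S < ⊤)
    {A B : Set (E n)} (g : geodesicSet a S A B) :
    pathCost a S (geodesicPath ha hS g) ≤ urbanDist a S (g.1 0) (g.1 1) := by
  rw [pathCost_eq hS]
  exact g.2.2.2.costMeasure_range_le ha hS hSfin

end Geodesics

/-! ### Transport plans versus measures on curves -/

section Plans

variable {n : ℕ} {a : ℝ} {S : Set (E n)}

theorem transportPlans_nonempty (μp μm : Measure (E n)) [IsFiniteMeasure μp] [IsFiniteMeasure μm]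
    (hmass : μp univ = μm univ) : (transportPlans μp μm).Nonempty := by
  rcases eq_or_ne (μp univ) 0 with h | h
  · have hp : μp = 0 := Measure.measure_univ_eq_zero.1 h
    have hm : μm = 0 := Measure.measure_univ_eq_zero.1 (hmass ▸ h)
    exact ⟨0, inferInstance, by simp [hp], by simp [hm]⟩
  · have hinv : (μp univ)⁻¹ * μp univ = 1 := ENNReal.inv_mul_cancel h (measure_ne_top _ _)
    refine ⟨(μp univ)⁻¹ • μp.prod μm, ?_, ?_, ?_⟩
    · exact Measure.smul_finite _ (ENNReal.inv_ne_top.2 h)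
    · rw [Measure.map_smul, Measure.map_fst_prod, ← hmass, smul_smul, hinv, one_smul]
    · rw [Measure.map_smul, Measure.map_snd_prod, smul_smul, hinv, one_smul]

theorem ae_mem_prod_of_mem_transportPlans {μp μm : Measure (E n)} {γ : Measure (E n × E n)}
    (hγ : γ ∈ transportPlans μp μm) {A B : Set (E n)} (hA : ∀ᵐ x ∂μp, x ∈ A)
    (hB : ∀ᵐ x ∂μm, x ∈ B) : ∀ᵐ z ∂γ, z ∈ A ×ˢ B := by
  obtain ⟨-, rfl, rfl⟩ := hγ
  filter_upwards [ae_of_ae_map measurable_fst.aemeasurable hA,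
    ae_of_ae_map measurable_snd.aemeasurable hB] with z h1 h2 using ⟨h1, h2⟩

/-- The joint law of the two endpoints is a transport plan, and every curve costs at least the
distance of its endpoints. -/
theorem wasserstein_le_tpmCost {μp μm : Measure (E n)} [IsFiniteMeasure μp]
    {η : Measure (LipPath n)} (hη : η ∈ transportPathMeasures μp μm) :
    wasserstein a S μp μm ≤ tpmCost a S η := by
  obtain ⟨h0, h1⟩ := hη
  have he : Measurable fun θ : LipPath n => (θ 0, θ 1) :=
    LipPath.measurable_eval_zero.prodMk LipPath.measurable_eval_one
  have hfin : IsFiniteMeasure η := by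
    constructor
    rw [← preimage_univ (f := fun θ : LipPath n => θ 0),
      ← Measure.map_apply LipPath.measurable_eval_zero MeasurableSet.univ, h0]
    exact measure_lt_top _ _
  have hplan : η.map (fun θ => (θ 0, θ 1)) ∈ transportPlans μp μm := by
    refine ⟨inferInstance, ?_, ?_⟩
    · rw [Measure.map_map measurable_fst he]
      exact h0
    · rw [Measure.map_map measurable_snd he]
      exact h1
  refine (iInf₂_le _ hplan).trans ((lintegral_map_le _ _).trans (lintegral_mono fun θ => ?_))
  exact iInf₂_le θ ⟨rfl, rfl⟩

theorem measurable_urbanDist (ha : 1 ≤ a) (hS : MeasurableSet S) :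
    Measurable fun z : E n × E n => urbanDist a S z.1 z.2 := by
  simp only [← ofReal_realDist ha hS]
  exact ENNReal.measurable_ofReal.comp (continuous_realDist ha hS).measurable

/-- Every transport plan is induced by a measure on the space of geodesics. -/
theorem exists_lift_transportPlan (ha : 1 ≤ a) (hS : MeasurableSet S) {A B : Set (E n)}
    (hA : IsCompact A) (hB : IsCompact B) [MeasurableSpace (geodesicSet a S A B)]
    [BorelSpace (geodesicSet a S A B)] {μp μm : Measure (E n)} {γ : Measure (E n × E n)}
    (hγ : γ ∈ transportPlans μp μm) (hAp : ∀ᵐ x ∂μp, x ∈ A) (hBm : ∀ᵐ x ∂μm, x ∈ B) :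
    ∃ η : FiniteMeasure (geodesicSet a S A B),
      (η : Measure (geodesicSet a S A B)).map (fun g => (g.1 0, g.1 1)) = γ := by
  have := isCompact_iff_compactSpace.1 (isCompact_geodesicSet ha hS hA hB)
  have := hγ.1
  have hAB : MeasurableSet (A ×ˢ B) := (hA.prod hB).measurableSet
  let p : geodesicSet a S A B → (A ×ˢ B : Set (E n × E n)) :=
    fun g => ⟨(g.1 0, g.1 1), g.2.1, g.2.2.1⟩
  have hp : Continuous p := Continuous.subtype_mk
    (((continuous_eval_const 0).comp continuous_subtype_val).prodMk
      ((continuous_eval_const 1).comp continuous_subtype_val)) _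
  have hsurj : Function.Surjective p := by
    rintro ⟨⟨x, y⟩, hx, hy⟩
    obtain ⟨f, h0, h1, hf⟩ := exists_isGeodesic (a := a) ha hS x y
    refine ⟨⟨⟨f, (hf.lipschitzWith ha hS).continuous⟩, ?_, ?_, hf⟩, ?_⟩
    · simpa [h0] using hx
    · simpa [h1] using hy
    · exact Subtype.ext (Prod.ext h0 h1)
  have hcom : (γ.comap ((↑) : (A ×ˢ B : Set (E n × E n)) → E n × E n)).map (↑) = γ := by
    rw [map_comap_subtype_coe hAB,
      Measure.restrict_eq_self_of_ae_mem (ae_mem_prod_of_mem_transportPlans hγ hAp hBm)]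
  have hfin : IsFiniteMeasure (γ.comap ((↑) : (A ×ˢ B : Set (E n × E n)) → E n × E n)) := by
    constructor
    rw [← preimage_univ (f := ((↑) : (A ×ˢ B : Set (E n × E n)) → E n × E n)),
      ← Measure.map_apply measurable_subtype_coe MeasurableSet.univ, hcom]
    exact measure_lt_top _ _
  obtain ⟨η, hη⟩ := exists_finiteMeasure_map_eq hp hsurj ⟨_, hfin⟩
  refine ⟨η, ?_⟩
  have h2 := congrArg (fun ν : FiniteMeasure (A ×ˢ B : Set (E n × E n)) =>
    (ν : Measure (A ×ˢ B : Set (E n × E n))).map ((↑) : _ → E n × E n)) hη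
  simp only [FiniteMeasure.toMeasure_map, FiniteMeasure.toMeasure_mk, hcom] at h2
  rwa [Measure.map_map measurable_subtype_coe hp.measurable] at h2

end Plans

end UrbanPlanning

/-! ### The minimiser -/

theorem proposition4p5 (n : ℕ) (a : ℝ) (ha : 1 < a)
    (S : Set (EuclideanSpace ℝ (Fin n))) (hSm : MeasurableSet S) (hSb : Bornology.IsBounded S)
    (hSfin : MeasureTheory.Measure.hausdorffMeasure 1 S < ⊤)
    (μp μm : MeasureTheory.Measure (EuclideanSpace ℝ (Fin n)))
    [MeasureTheory.IsFiniteMeasure μp] [MeasureTheory.IsFiniteMeasure μm]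
    (hmass : μp Set.univ = μm Set.univ)
    (hp : IsCompact μp.support) (hm : IsCompact μm.support) :
    ∃ η ∈ UrbanPlanning.transportPathMeasures μp μm,
      IsMinOn (UrbanPlanning.tpmCost a S) (UrbanPlanning.transportPathMeasures μp μm) η ∧
      (∀ᵐ θ ∂η, UrbanPlanning.LipPath.LoopFree θ) ∧
      UrbanPlanning.tpmCost a S η = UrbanPlanning.wasserstein a S μp μm := by
  open UrbanPlanning in
  let G := geodesicSet a S μp.support μm.support
  let _ : MeasurableSpace G := borel G
  have : BorelSpace G := ⟨rfl⟩
  have hG : CompactSpace G :=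
    isCompact_iff_compactSpace.1 (isCompact_geodesicSet ha.le hSm hp hm)
  have he₀ : Continuous fun g : G => g.1 0 :=
    (continuous_eval_const 0).comp continuous_subtype_val
  have he₁ : Continuous fun g : G => g.1 1 :=
    (continuous_eval_const 1).comp continuous_subtype_val
  have hlift : ∀ γ ∈ transportPlans μp μm, ∃ η : FiniteMeasure G,
      (η : Measure G).map (fun g => (g.1 0, g.1 1)) = γ := fun γ hγ =>
    exists_lift_transportPlan ha.le hSm hp hm hγ Measure.support_mem_ae Measure.support_mem_ae
  let Mp : FiniteMeasure (E n) := ⟨μp, inferInstance⟩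
  let Mm : FiniteMeasure (E n) := ⟨μm, inferInstance⟩
  have hmarg : ∀ γ ∈ transportPlans μp μm, ∀ η : FiniteMeasure G,
      (η : Measure G).map (fun g => (g.1 0, g.1 1)) = γ →
      η.map (fun g => g.1 0) = Mp ∧ η.map (fun g => g.1 1) = Mm := by
    rintro γ ⟨-, h0, h1⟩ η hη
    have hpm : Measurable fun g : G => (g.1 0, g.1 1) := he₀.measurable.prodMk he₁.measurable
    rw [← hη, Measure.map_map measurable_fst hpm] at h0
    rw [← hη, Measure.map_map measurable_snd hpm] at h1
    exact ⟨Subtype.ext h0, Subtype.ext h1⟩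
  -- The minimised cost is the distance of the endpoints, which is continuous on `G` and bounds
  -- `pathCost` from above there.
  let c : C(G, ℝ≥0) := ⟨fun g => (realDist a S (g.1 0) (g.1 1)).toNNReal,
    continuous_real_toNNReal.comp (continuous_realDist_comp ha.le hSm he₀ he₁)⟩
  have hc : ∀ g, (c g : ℝ≥0∞) = urbanDist a S (g.1 0) (g.1 1) := fun g =>
    ofReal_realDist ha.le hSm _ _
  obtain ⟨γ₀, hγ₀⟩ := transportPlans_nonempty μp μm hmass
  obtain ⟨η₀, hη₀⟩ := hlift γ₀ hγ₀
  obtain ⟨η, ⟨hη0, hη1⟩, hmin⟩ := exists_minimiser_of_marginals he₀ he₁ Mp Mm c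
    ⟨η₀, hmarg γ₀ hγ₀ η₀ hη₀⟩
  have hι : Continuous (geodesicPath ha.le hSm : G → LipPath n) :=
    continuous_geodesicPath ha.le hSm
  have hTPM : (η : Measure G).map (geodesicPath ha.le hSm) ∈ transportPathMeasures μp μm := by
    refine ⟨?_, ?_⟩
    · rw [Measure.map_map LipPath.measurable_eval_zero hι.measurable]
      exact congrArg Subtype.val hη0
    · rw [Measure.map_map LipPath.measurable_eval_one hι.measurable]
      exact congrArg Subtype.val hη1
  have hle : tpmCost a S ((η : Measure G).map (geodesicPath ha.le hSm)) ≤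
      wasserstein a S μp μm := by
    refine le_iInf₂ fun γ hγ => ?_
    obtain ⟨η', hη'⟩ := hlift γ hγ
    obtain ⟨h0, h1⟩ := hmarg γ hγ η' hη'
    -- This direction of the change of variables needs no measurability of `pathCost`.
    calc _ ≤ ∫⁻ g, pathCost a S (geodesicPath ha.le hSm g) ∂(η : Measure G) :=
          lintegral_map_le _ _
      _ ≤ ∫⁻ g, c g ∂(η : Measure G) := lintegral_mono fun g =>
          (pathCost_geodesicPath_le ha.le hSm hSfin g).trans_eq (hc g).symm
      _ ≤ ∫⁻ g, c g ∂(η' : Measure G) := hmin η' h0 h1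
      _ = ∫⁻ z, urbanDist a S z.1 z.2 ∂γ := by
          rw [← hη', lintegral_map (measurable_urbanDist ha.le hSm)
            (he₀.measurable.prodMk he₁.measurable)]
          exact lintegral_congr hc
  refine ⟨_, hTPM, ?_, ?_, le_antisymm hle (wasserstein_le_tpmCost hTPM)⟩
  · exact isMinOn_iff.2 fun η' hη' => hle.trans (wasserstein_le_tpmCost hη')
  -- In a pseudometric space a compact image need not be closed. Its closure is Borel and only adds
  -- curves inseparable from geodesics, which are loop-free as well.
  · have hcl : ∀ᵐ θ ∂(η : Measure G).map (geodesicPath ha.le hSm),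
        θ ∈ closure (range (geodesicPath ha.le hSm : G → LipPath n)) := by
      refine (ae_map_iff hι.measurable.aemeasurable
        (p := fun θ => θ ∈ closure (range (geodesicPath ha.le hSm : G → LipPath n)))
        isClosed_closure.measurableSet).2 ?_
      exact Filter.Eventually.of_forall fun g => subset_closure ⟨g, rfl⟩
    filter_upwards [hcl] with θ hθ
    rw [(isCompact_range hι).closure_eq_biUnion_inseparable] at hθ
    simp only [mem_iUnion, mem_ofPred_eq] at hθ
    obtain ⟨_, ⟨g, rfl⟩, hg⟩ := hθ
    exact LipPath.loopFree_of_inseparable ha.le hSm (g := geodesicPath ha.le hSm g)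
      g.2.2.2 hg.symm
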